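/- Let $p\in(0,1)$, $q:=1-p$ and $m\in[1,\infty)$. Let $\mathsf{BS}(p)$ denote the standardized Bernoulli distribution, that is, the distribution of a random variable that takes the value $\sqrt{q/p}$ with probability $p$ and the value $-\sqrt{p/q}$ with probability $q$, and let $\mathrm{BS}_1,\mathrm{BS}_2,\dots$ be i.i.d. random variables with distribution $\mathsf{BS}(p)$. For $r\in(0,1)$ put $$m_*(r):=\begin{cases}\dfrac{1+r+2r^2}{2\left(\sqrt{r-r^2}+2r^2\right)}&\text{if }0<r\le\frac12,\\[1ex] 1&\text{if }\frac12\le r<1.\end{cases}$$ Let $\mathcal F_-$ be the class of all twice continuously differentiable functions $f\colon\mathbb R\to\mathbb R$ such that $f$ and $f''$ are nonincreasing and convex. For $\mathbf a,\mathbf b\in\mathbb R^n$ write $\mathbf a\succeq\mathbf b$ if $a_1+\dots+a_n=b_1+\dots+b_n$ and $a_{[1]}+\dots+a_{[j]}\ge b_{[1]}+\dots+b_{[j]}$ for all $j\in\{1,\dots,n\}$, where $a_{[1]}\ge\dots\ge a_{[n]}$ are the numbers $a_1,\dots,a_n$ in decreasing order; a function $Q\colon[0,\infty)^n\to\mathbb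 R$ is called Schur-concave if $Q(\mathbf a)\le Q(\mathbf b)$ for all $\mathbf a,\mathbf b\in[0,\infty)^n$ such that $\mathbf a\succeq\mathbf b$. Then the following statements are equivalent to one another. (I) $m\ge m_*(q)$. (II) For all $f\in\mathcal F_-$, all natural $n\ge2$, and all nonnegative numbers $c_1,\dots,c_n$, $$\mathsf E f(c_1\mathrm{BS}_1+\dots+c_n\mathrm{BS}_n)\le\mathsf E f\big(s\cdot(\mathrm{BS}_1+\dots+\mathrm{BS}_n)\big),\qquad s:=\Big(\frac1n\sum_{i=1}^n c_i^{2m}\Big)^{\frac1{2m}}.$$ (III) The same as (II), but only for $n=2$. (IV) For every natural $n\ge2$ and every $f\in\mathcal F_-$, the function $$[0,\infty)^n\ni(a_1,\dots,a_n)\longmapsto\mathsf E f\big(a_1^{1/(2m)}\mathrm{BS}_1+\dots+a_n^{1/(2m)}\mathrm{BS}_n\big)$$ is Schur-concave. (V) The same as (IV), but only for $n=2$. (VI) For every natural $n\ge1$ and all independent random variables $X_1,\dots,X_n$ such that for every $i$ one has $\mathsf E X_i\ge0$ and $-a_i\le X_i\le b_i$ almost surely, where $a_i$ and $b_i$ are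 positive numbers with $\frac{a_i}{b_i}\le\frac pq$, and for all $f\in\mathcal F_-$, the random variable $f(X_1+\dots+X_n)$ is integrable and $$\mathsf E f(X_1+\dots+X_n)\le\mathsf E f\big(s\cdot(\mathrm{BS}_1+\dots+\mathrm{BS}_n)\big),\qquad s:=\Big(\frac1n\sum_{i=1}^n (a_ib_i)^{m}\Big)^{\frac1{2m}}.$$ (VII) For every natural $n\ge1$, every submartingale $(S_0,\dots,S_n)$ relative to a nondecreasing sequence of $\sigma$-algebras $(H_{\le0},\dots,H_{\le n})$ with $S_0\ge0$ almost surely, all real numbers $c_1,\dots,c_n$, and all $H_{\le i-1}$-measurable random variables $A_{i-1}$, $B_{i-1}$ ($i=1,\dots,n$) such that, almost surely for every $i\in\{1,\dots,n\}$, $$A_{i-1}>0,\quad B_{i-1}>0,\quad -A_{i-1}\le S_i-S_{i-1}\le B_{i-1},\quad \sqrt{A_{i-1}B_{i-1}}\le c_i,\quad \frac{A_{i-1}}{B_{i-1}}\le\frac pq,$$ and for all $f\in\mathcal F_-$, the random variable $f(S_n)$ is integrable and $$\mathsf E f(S_n)\le\mathsf E f\big(s\cdot(\mathrm{BS}_1+\dots+\mathrm{BS}_n)\big),\qquad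 s:=\Big(\frac1n\sum_{i=1}^n c_i^{2m}\Big)^{\frac1{2m}}.$$ -/

import Mathlib

open MeasureTheory ProbabilityTheory

universe u

namespace LeftTail

/-- The standardized Bernoulli law with parameter `p`: mass `p` at `√(q/p)` and mass `q` at
`-√(p/q)`, where `q = 1 - p`. -/
noncomputable def bsLaw (p : ℝ) : Measure ℝ :=
  ENNReal.ofReal p • Measure.dirac (√((1 - p) / p)) +
    ENNReal.ofReal (1 - p) • Measure.dirac (-√(p / (1 - p)))

/-- The joint law on `ℝⁿ` of `n` independent random variables, each with law `bsLaw p`. -/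
noncomputable def bsLawPi (p : ℝ) (n : ℕ) : Measure (Fin n → ℝ) :=
  Measure.pi fun _ => bsLaw p

/-- `E f(c₁ BS₁ + ⋯ + cₙ BSₙ)` for i.i.d. `BS₁, …, BSₙ` with law `bsLaw p`. -/
noncomputable def bsMoment (p : ℝ) {n : ℕ} (f : ℝ → ℝ) (c : Fin n → ℝ) : ℝ :=
  ∫ x, f (∑ i, c i * x i) ∂(bsLawPi p n)

/-- The threshold `m_*(p)`. -/
noncomputable def mStar (p : ℝ) : ℝ :=
  if p ≤ 1 / 2 then (1 + p + 2 * p ^ 2) / (2 * (√(p - p ^ 2) + 2 * p ^ 2)) else 1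

/-- The class of twice continuously differentiable functions `f : ℝ → ℝ` such that `f` and `f''`
are nonincreasing and convex. -/
def FMinus3 : Set (ℝ → ℝ) :=
  {f | ContDiff ℝ 2 f ∧
    Antitone f ∧ ConvexOn ℝ Set.univ f ∧
    Antitone (iteratedDeriv 2 f) ∧ ConvexOn ℝ Set.univ (iteratedDeriv 2 f)}

/-- The coordinates of `a` arranged from the largest to the smallest. -/
noncomputable def decreasing {n : ℕ} (a : Fin n → ℝ) (i : Fin n) : ℝ :=
  a (Tuple.sort a i.rev)

/-- Schur majorization: `a ⪰ b`. -/
def Majorizes {n : ℕ} (a b : Fin n → ℝ) : Prop :=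
  ∑ i, a i = ∑ i, b i ∧
    ∀ j : Fin n, ∑ i ∈ Finset.Iic j, decreasing b i ≤ ∑ i ∈ Finset.Iic j, decreasing a i

/-- Schur concavity on `[0, ∞)ⁿ`. -/
def SchurConcave {n : ℕ} (Q : (Fin n → ℝ) → ℝ) : Prop :=
  ∀ a b : Fin n → ℝ, (∀ i, 0 ≤ a i) → (∀ i, 0 ≤ b i) → Majorizes a b → Q a ≤ Q b

/-- `s = ((1/n) ∑ cᵢ^(2m))^(1/(2m))`. -/
noncomputable def powerMean (m : ℝ) {n : ℕ} (c : Fin n → ℝ) : ℝ :=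
  (1 / (n : ℝ) * ∑ i, c i ^ (2 * m)) ^ (1 / (2 * m))

end LeftTail

namespace LeftTail

/-! Write `p = a²`, `1 - p = b²`, `θ = b(a+b)`. For `b ≤ a` the threshold condition says `(2m-1)θ ≥
1` (`mStar_sq`); for `b > a` it is just `m ≥ 1`.

Sufficiency is a two-summand problem. Put `x = τ^(1/(2m))` and `y = (σ-τ)^(1/(2m))` with `x ≥ y`.
The claim is that `E f(x BS₁ + y BS₂)` decreases in `τ`. The sign of the derivative compares `f'` at
the four values of the sum, which after rescaling are `0, 1, ρ, ρ+1` with `ρ = x/y`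
(`weighted_slopes_le`). With `F` a positive multiple of the rescaled `f''`, hence nonnegative,
nonincreasing and convex, this says that a combination of the integrals of `F` over the three gaps
is nonnegative. Only the middle gap carries a negative weight, so `F` may be replaced by the
positive part of its chord over that gap (`four_point_nonneg`). What remains is a quadratic in the
zero of the chord (`quadratic_nonneg_of_le`), and its sign comes from a one-variable inequality with
the sharp exponent `θ` (`rpow_threshold_le`). Averaging over the other summands and decomposing
majorization into two-coordinate transfers gives Schur concavity in every dimension; the constant
vector is majorized by every vector with the same mean, which yields the power-mean bounds.

Necessity: test coefficients `1 ± ε` against a truncated cube `(t - x)₊³` and compare the terms of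
order `ε²`; the best cutoff `t` yields exactly `(2m-1)θ ≥ 1` (`mStar_le_of_bsMoment_le`).

For submartingales, convexity and monotonicity of `f` bound each step by a centred two-point law.
Monotonicity of `f''` moves that law to the extreme allowed asymmetry, and convexity enlarges its
scale, giving a standardized Bernoulli step (`integral_step_le`). Averaging over such a step stays
in the class, so induction gives the bound with coefficients `cᵢ`, which the power-mean inequality
then equalizes. Independent sums are a special case, and scaled Bernoulli variables are a special
case of those, which closes the circle. -/

/-! ### The law `bsLaw` and the functional `bsMoment` as finite sums -/

/-- The weight of the outcome `s` of a Bernoulli trial with success probability `p`. -/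
noncomputable def bsWeight (p : ℝ) (s : Bool) : ℝ := if s then p else 1 - p

/-- The standardized value of the outcome `s` of a Bernoulli trial with success probability `p`. -/
noncomputable def bsValue (p : ℝ) (s : Bool) : ℝ := if s then √((1 - p) / p) else -√(p / (1 - p))

lemma bsWeight_nonneg {p : ℝ} (hp₀ : 0 < p) (hp₁ : p < 1) (s : Bool) : 0 ≤ bsWeight p s := by
  unfold bsWeight
  split_ifs <;> linarith

lemma isProbabilityMeasure_bsLaw {p : ℝ} (hp₀ : 0 < p) (hp₁ : p < 1) :
    IsProbabilityMeasure (bsLaw p) := by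
  constructor
  simp only [bsLaw, Measure.coe_add, Measure.coe_smul, Pi.add_apply, Pi.smul_apply, measure_univ,
    smul_eq_mul, mul_one]
  rw [← ENNReal.ofReal_add hp₀.le (by linarith)]
  simp

/-- The law of a Bernoulli trial. -/
noncomputable def coinLaw (p : ℝ) : Measure Bool :=
  ENNReal.ofReal p • Measure.dirac true + ENNReal.ofReal (1 - p) • Measure.dirac false

instance isFiniteMeasure_coinLaw (p : ℝ) : IsFiniteMeasure (coinLaw p) := by
  unfold coinLaw
  constructor
  simp [ENNReal.add_lt_top]

lemma map_coinLaw (p : ℝ) : (coinLaw p).map (bsValue p) = bsLaw p := by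
  have h : Measurable (bsValue p) := measurable_of_finite _
  rw [coinLaw, Measure.map_add _ _ h, Measure.map_smul, Measure.map_smul, Measure.map_dirac' h,
    Measure.map_dirac' h]
  simp [bsLaw, bsValue]

lemma coinLaw_singleton {p : ℝ} (s : Bool) :
    coinLaw p {s} = ENNReal.ofReal (bsWeight p s) := by
  cases s <;> simp [coinLaw, bsWeight]

/-- Pulling the product law back to the finite space of coin outcomes removes all integrability
questions. -/
lemma bsMoment_eq_sum {p : ℝ} (hp₀ : 0 < p) (hp₁ : p < 1) {n : ℕ} {f : ℝ → ℝ}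
    (hf : Continuous f) (c : Fin n → ℝ) :
    bsMoment p f c =
      ∑ s : Fin n → Bool, (∏ i, bsWeight p (s i)) * f (∑ i, c i * bsValue p (s i)) := by
  have hb : Measurable (bsValue p) := measurable_of_finite _
  have hmap : bsLawPi p n =
      (Measure.pi fun _ : Fin n => coinLaw p).map (fun s i => bsValue p (s i)) := by
    rw [Measure.pi_map_pi (fun _ => hb.aemeasurable)]
    simp only [map_coinLaw, bsLawPi]
  rw [bsMoment, hmap, integral_map (measurable_of_finite _).aemeasurable
    (Continuous.aestronglyMeasurable (by fun_prop)), integral_fintype .of_finite]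
  refine Finset.sum_congr rfl fun s _ => ?_
  rw [measureReal_def, Measure.pi_singleton]
  simp only [coinLaw_singleton, smul_eq_mul, ENNReal.toReal_prod]
  congr 1
  exact Finset.prod_congr rfl fun i _ => ENNReal.toReal_ofReal (bsWeight_nonneg hp₀ hp₁ _)

lemma bsMoment_mono {p : ℝ} (hp₀ : 0 < p) (hp₁ : p < 1) {n : ℕ} {f g : ℝ → ℝ}
    (hf : Continuous f) (hg : Continuous g) (h : ∀ x, f x ≤ g x) (c : Fin n → ℝ) :
    bsMoment p f c ≤ bsMoment p g c := by
  rw [bsMoment_eq_sum hp₀ hp₁ hf, bsMoment_eq_sum hp₀ hp₁ hg]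
  exact Finset.sum_le_sum fun s _ =>
    mul_le_mul_of_nonneg_left (h _) (Finset.prod_nonneg fun i _ => bsWeight_nonneg hp₀ hp₁ _)

lemma bsMoment_comp_perm {p : ℝ} (hp₀ : 0 < p) (hp₁ : p < 1) {n : ℕ} {f : ℝ → ℝ}
    (hf : Continuous f) (c : Fin n → ℝ) (e : Equiv.Perm (Fin n)) :
    bsMoment p f (fun i => c (e i)) = bsMoment p f c := by
  rw [bsMoment_eq_sum hp₀ hp₁ hf, bsMoment_eq_sum hp₀ hp₁ hf]
  rw [← (Equiv.arrowCongr e.symm (Equiv.refl Bool)).sum_comp]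
  refine Finset.sum_congr rfl fun s _ => ?_
  simp only [Equiv.arrowCongr_apply, Equiv.coe_refl, Function.comp_apply, id_eq, Equiv.symm_symm]
  rw [Equiv.prod_comp e (fun i => bsWeight p (s i)),
    Equiv.sum_comp e (fun i => c i * bsValue p (s i))]

/-- The average of `f` over one more standardized Bernoulli summand with coefficient `c`. -/
noncomputable def bsAverage (p : ℝ) (f : ℝ → ℝ) (c : ℝ) (y : ℝ) : ℝ :=
  p * f (y + c * √((1 - p) / p)) + (1 - p) * f (y - c * √(p / (1 - p)))

lemma continuous_bsAverage {p : ℝ} {f : ℝ → ℝ} (hf : Continuous f) (c : ℝ) :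
    Continuous (bsAverage p f c) := by
  unfold bsAverage
  fun_prop

/-- Conditioning on all summands but one. The index is arbitrary, so that any pair can be isolated
for a transfer and the last step can be peeled off a submartingale. -/
lemma bsMoment_succAbove {p : ℝ} (hp₀ : 0 < p) (hp₁ : p < 1) {n : ℕ} {f : ℝ → ℝ}
    (hf : Continuous f) (c : Fin (n + 1) → ℝ) (i : Fin (n + 1)) :
    bsMoment p f c = bsMoment p (bsAverage p f (c i)) (fun j => c (i.succAbove j)) := by
  rw [bsMoment_eq_sum hp₀ hp₁ hf, bsMoment_eq_sum hp₀ hp₁ (continuous_bsAverage hf _)]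
  rw [← (Fin.insertNthEquiv (fun _ => Bool) i).sum_comp, Fintype.sum_prod_type]
  simp only [Fin.insertNthEquiv_apply, Fin.prod_univ_succAbove _ i, Fin.sum_univ_succAbove _ i,
    Fin.insertNth_apply_same, Fin.insertNth_apply_succAbove, Fintype.univ_bool]
  rw [Finset.sum_pair (by decide), ← Finset.sum_add_distrib]
  refine Finset.sum_congr rfl fun s _ => ?_
  simp only [bsAverage, bsWeight, bsValue, if_true, Bool.false_eq_true, if_false]
  rw [add_comm (∑ i_1, _), sub_eq_add_neg (∑ i_1, _), add_comm (∑ i_1, _) (-_), ← mul_neg]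
  ring

lemma bsMoment_zero {p : ℝ} (hp₀ : 0 < p) (hp₁ : p < 1) {f : ℝ → ℝ} (hf : Continuous f)
    (c : Fin 0 → ℝ) : bsMoment p f c = f 0 := by
  rw [bsMoment_eq_sum hp₀ hp₁ hf]
  simp

/-- `E f(x BS₁ + y BS₂)`. -/
noncomputable def bsTwo (p : ℝ) (f : ℝ → ℝ) (x y : ℝ) : ℝ := bsAverage p (bsAverage p f y) x 0

lemma bsMoment_two {p : ℝ} (hp₀ : 0 < p) (hp₁ : p < 1) {f : ℝ → ℝ} (hf : Continuous f)
    (c : Fin 2 → ℝ) : bsMoment p f c = bsTwo p f (c 0) (c 1) := by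
  rw [bsMoment_succAbove hp₀ hp₁ hf c 1,
    bsMoment_succAbove hp₀ hp₁ (continuous_bsAverage hf _) _ 0, bsMoment_zero hp₀ hp₁
    (continuous_bsAverage (continuous_bsAverage hf _) _)]
  rfl

/-! ### The class `FMinus3` -/

lemma mem_FMinus3_iff {f : ℝ → ℝ} :
    f ∈ FMinus3 ↔ ∃ f₁ f₂ : ℝ → ℝ, (∀ x, HasDerivAt f (f₁ x) x) ∧ (∀ x, HasDerivAt f₁ (f₂ x) x) ∧
      Continuous f₂ ∧ Antitone f ∧ ConvexOn ℝ Set.univ f ∧ Antitone f₂ ∧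
      ConvexOn ℝ Set.univ f₂ := by
  have key : ∀ g : ℝ → ℝ, iteratedDeriv 2 g = deriv (deriv g) := fun g => by
    rw [iteratedDeriv_succ, iteratedDeriv_one]
  constructor
  · rintro ⟨hc, ha, hv, ha2, hv2⟩
    rw [key] at ha2 hv2
    have h2 := hc
    rw [show (2 : WithTop ℕ∞) = 1 + 1 by norm_num, contDiff_succ_iff_deriv,
      contDiff_one_iff_deriv] at h2
    exact ⟨deriv f, deriv (deriv f), fun x => (h2.1 x).hasDerivAt,
      fun x => (h2.2.2.1 x).hasDerivAt, h2.2.2.2, ha, hv, ha2, hv2⟩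
  · rintro ⟨f₁, f₂, h1, h2, hc, ha, hv, ha2, hv2⟩
    have e1 : deriv f = f₁ := funext fun x => (h1 x).deriv
    have e2 : deriv f₁ = f₂ := funext fun x => (h2 x).deriv
    refine ⟨?_, ha, hv, ?_, ?_⟩
    · rw [show (2 : WithTop ℕ∞) = 1 + 1 by norm_num, contDiff_succ_iff_deriv,
        contDiff_one_iff_deriv, e1, e2]
      exact ⟨fun x => (h1 x).differentiableAt, by simp, fun x => (h2 x).differentiableAt, hc⟩
    · rwa [key, e1, e2]
    · rwa [key, e1, e2]

lemma FMinus3.continuous {f : ℝ → ℝ} (hf : f ∈ FMinus3) : Continuous f := hf.1.continuous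

lemma FMinus3.comp_add_const {f : ℝ → ℝ} (hf : f ∈ FMinus3) (d : ℝ) :
    (fun x => f (x + d)) ∈ FMinus3 := by
  obtain ⟨f₁, f₂, h1, h2, hc, ha, hv, ha2, hv2⟩ := mem_FMinus3_iff.1 hf
  refine mem_FMinus3_iff.2 ⟨fun x => f₁ (x + d), fun x => f₂ (x + d),
    fun x => (h1 (x + d)).comp_add_const x d, fun x => (h2 (x + d)).comp_add_const x d,
    by fun_prop, fun x y h => ha (by linarith), ?_, fun x y h => ha2 (by linarith), ?_⟩
  · simpa [Function.comp_def] using hv.translate_left d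
  · simpa [Function.comp_def] using hv2.translate_left d

lemma FMinus3.add {f g : ℝ → ℝ} (hf : f ∈ FMinus3) (hg : g ∈ FMinus3) {s t : ℝ} (hs : 0 ≤ s)
    (ht : 0 ≤ t) : (fun x => s * f x + t * g x) ∈ FMinus3 := by
  obtain ⟨f₁, f₂, h1, h2, hc, ha, hv, ha2, hv2⟩ := mem_FMinus3_iff.1 hf
  obtain ⟨g₁, g₂, k1, k2, kc, ka, kv, ka2, kv2⟩ := mem_FMinus3_iff.1 hg
  refine mem_FMinus3_iff.2 ⟨fun x => s * f₁ x + t * g₁ x, fun x => s * f₂ x + t * g₂ x,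
    fun x => ((h1 x).const_mul s).add ((k1 x).const_mul t),
    fun x => ((h2 x).const_mul s).add ((k2 x).const_mul t), by fun_prop,
    fun x y h => add_le_add (mul_le_mul_of_nonneg_left (ha h) hs)
      (mul_le_mul_of_nonneg_left (ka h) ht),
    (hv.smul hs).add (kv.smul ht),
    fun x y h => add_le_add (mul_le_mul_of_nonneg_left (ha2 h) hs)
      (mul_le_mul_of_nonneg_left (ka2 h) ht),
    (hv2.smul hs).add (kv2.smul ht)⟩

lemma FMinus3.bsAverage {p : ℝ} (hp₀ : 0 < p) (hp₁ : p < 1) {f : ℝ → ℝ} (hf : f ∈ FMinus3)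
    (c : ℝ) : bsAverage p f c ∈ FMinus3 := by
  have := FMinus3.add (FMinus3.comp_add_const hf (c * √((1 - p) / p)))
    (FMinus3.comp_add_const hf (-(c * √(p / (1 - p))))) hp₀.le (sub_nonneg.2 hp₁.le)
  exact this

/-! ### The scalar inequalities behind the threshold -/

/-- The difference of the two sides vanishes at `w = 1` and is monotone in `w`, its derivative
having an explicit sign. -/
lemma log_threshold_le {a b w : ℝ} (hb : 0 < b) (hab : b < a) (h1 : a ^ 2 + b ^ 2 = 1)
    (hw : b / a < w) (hw1 : w ≤ 1) :
    b * (a + b) * (Real.log (a - b * w) + Real.log (a + b * w) - Real.log (a * w - b)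
        - Real.log (a * w + b)) ≤
      Real.log w + Real.log (a - b * w) - Real.log (a * w - b) := by
  have ha : 0 < a := hb.trans hab
  set G : ℝ → ℝ := fun w => Real.log w + Real.log (a - b * w) - Real.log (a * w - b) -
    b * (a + b) * (Real.log (a - b * w) + Real.log (a + b * w) - Real.log (a * w - b)
        - Real.log (a * w + b)) with hG
  have pos : ∀ x ∈ Set.Icc w 1, 0 < x ∧ 0 < a - b * x ∧ 0 < a * x - b ∧ 0 < a + b * x ∧
      0 < a * x + b := by
    intro x hx
    have hx0 : b / a < x := hw.trans_le hx.1
    have hxp : 0 < x := (div_pos hb ha).trans hx0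
    have : b < x * a := (div_lt_iff₀ ha).1 hx0
    exact ⟨hxp, by nlinarith [hx.2], by linarith, by positivity, by positivity⟩
  have hder : ∀ x ∈ Set.Icc w 1, HasDerivAt G (1 / x + (-b) / (a - b * x) - a / (a * x - b) -
      b * (a + b) * ((-b) / (a - b * x) + b / (a + b * x) - a / (a * x - b) - a / (a * x + b)))
      x := by
    intro x hx
    obtain ⟨p1, p2, p3, p4, p5⟩ := pos x hx
    have hbx : HasDerivAt (fun x => b * x) b x := by simpa using (hasDerivAt_id x).const_mul b
    have hax : HasDerivAt (fun x => a * x) a x := by simpa using (hasDerivAt_id x).const_mul a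
    have d2 := (hbx.const_sub a).log p2.ne'
    have d3 := (hax.sub_const b).log p3.ne'
    have d4 := (hbx.const_add a).log p4.ne'
    have d5 := (hax.add_const b).log p5.ne'
    exact ((((hasDerivAt_id x).log p1.ne').add d2).sub d3).sub
      ((((d2.add d4).sub d3).sub d5).const_mul _)
  have hanti : AntitoneOn G (Set.Icc w 1) := by
    refine antitoneOn_of_hasDerivWithinAt_nonpos (convex_Icc w 1)
      (fun x hx => (hder x hx).continuousAt.continuousWithinAt)
      (fun x hx => (hder x (interior_subset hx)).hasDerivWithinAt) ?_
    intro x hx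
    obtain ⟨p1, p2, p3, p4, p5⟩ := pos x (interior_subset hx)
    have hx1 : x ≤ 1 := (interior_subset hx : x ∈ Set.Icc w 1).2
    have e1 : (a - b * x) * (a * x - b) = x - a * b * (1 + x ^ 2) := by
      linear_combination x * h1
    have e2 : (a + b * x) * (a * x + b) = x + a * b * (1 + x ^ 2) := by
      linear_combination x * h1
    have q1 := mul_pos p2 p3
    have q2 := mul_pos p4 p5
    have hd : 0 < a ^ 2 - b ^ 2 := by nlinarith
    -- The coefficient `b(a+b)` is the one for which this derivative vanishes at `1`; the zero is
    -- double, so there is no change of sign.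
    have key : 1 / x + (-b) / (a - b * x) - a / (a * x - b) -
        b * (a + b) * ((-b) / (a - b * x) + b / (a + b * x) - a / (a * x - b) - a / (a * x + b))
        = -(a * b * (1 - x) ^ 2 * (a * b * (1 + x) ^ 2 + (a ^ 2 - b ^ 2) * x)) /
          (x * ((a - b * x) * (a * x - b)) * ((a + b * x) * (a * x + b))) := by
      have f1 : (-b) / (a - b * x) - a / (a * x - b) =
          -(a ^ 2 - b ^ 2) / ((a - b * x) * (a * x - b)) := by
        rw [div_sub_div _ _ p2.ne' p3.ne']; congr 1; ring
      have f2 : b / (a + b * x) - a / (a * x + b) =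
          -(a ^ 2 - b ^ 2) / ((a + b * x) * (a * x + b)) := by
        rw [div_sub_div _ _ p4.ne' p5.ne']; congr 1; ring
      have f3 : 1 / x + (-b) / (a - b * x) - a / (a * x - b) -
        b * (a + b) * ((-b) / (a - b * x) + b / (a + b * x) - a / (a * x - b) - a / (a * x + b))
        = 1 / x + (1 - b * (a + b)) * ((-b) / (a - b * x) - a / (a * x - b)) -
          b * (a + b) * (b / (a + b * x) - a / (a * x + b)) := by ring
      rw [f3, f1, f2, e1, e2]
      rw [e1] at q1
      rw [e2] at q2
      have g1 := q1.ne'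
      have g2 := q2.ne'
      have h0 := p1.ne'
      rw [mul_div_assoc', mul_div_assoc', div_add_div _ _ h0 g1, div_sub_div _ _ (by positivity) g2,
        div_eq_div_iff (by positivity) (by positivity)]
      have hb2 : 1 - b * (a + b) = a * (a - b) := by linear_combination -h1
      rw [hb2]
      have main : (1 * (x - a * b * (1 + x ^ 2)) + x * (a * (a - b) * -(a ^ 2 - b ^ 2))) *
          (x + a * b * (1 + x ^ 2)) - x * (x - a * b * (1 + x ^ 2)) *
          (b * (a + b) * -(a ^ 2 - b ^ 2)) =
          -(a * b * (1 - x) ^ 2 * (a * b * (1 + x) ^ 2 + (a ^ 2 - b ^ 2) * x)) := by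
        have : a ^ 2 = 1 - b ^ 2 := by linarith
        have h4 : a ^ 4 = (1 - b ^ 2) ^ 2 := by rw [← this]; ring
        have h3 : a ^ 3 = a * (1 - b ^ 2) := by rw [← this]; ring
        have h5 : a ^ 5 = a * (1 - b ^ 2) ^ 2 := by rw [← this]; ring
        ring_nf
        simp only [h5, h4, h3, this]
        ring_nf
      rw [main]
    rw [key]
    apply div_nonpos_of_nonpos_of_nonneg
    · rw [neg_nonpos]; positivity
    · positivity
  have hle := hanti (Set.left_mem_Icc.2 hw1) (Set.right_mem_Icc.2 hw1) hw1
  have h0 : G 1 = 0 := by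
    simp only [hG, mul_one, Real.log_one]
    ring
  rw [h0] at hle
  simp only [hG] at hle
  linarith

/-- The exponent is the value at `x = 0` of the bracket on the right, so both sides agree to first
order there. In terms of the square root `w`, both `1 + x` and the right side are rational with
linear factors, and taking logarithms leads to `log_threshold_le`. For `a = b` the parametrization
degenerates, but then `w = 1` and the exponent is `1`. -/
lemma rpow_threshold_le {a b x : ℝ} (hb : 0 < b) (hab : b ≤ a) (h1 : a ^ 2 + b ^ 2 = 1)
    (hx : 0 ≤ x) :
    (1 + x) ^ (b * (a + b)) ≤ 1 + x * (b ^ 2 + a * b * √((1 + b ^ 2 * x) / (1 + a ^ 2 * x))) := by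
  have ha : 0 < a := hb.trans_le hab
  set w := √((1 + b ^ 2 * x) / (1 + a ^ 2 * x)) with hw
  have hQ : 0 < 1 + b ^ 2 * x := by positivity
  have hP : 0 < 1 + a ^ 2 * x := by positivity
  have hw2 : w ^ 2 * (1 + a ^ 2 * x) = 1 + b ^ 2 * x := by
    rw [hw, Real.sq_sqrt (by positivity)]
    field_simp
  have hw0 : 0 < w := Real.sqrt_pos.2 (by positivity)
  rcases hab.eq_or_lt with rfl | hlt
  · have : w = 1 := by
      rw [hw, div_self hP.ne', Real.sqrt_one]
    rw [this, show b * (b + b) = 1 by linarith, Real.rpow_one]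
    nlinarith
  have hw1 : w ≤ 1 := by
    rw [hw]
    apply Real.sqrt_le_one.2
    rw [div_le_one hP]
    nlinarith [mul_nonneg hx (mul_pos (sub_pos.2 hlt) (add_pos ha hb)).le]
  have hwb : b / a < w := by
    rw [hw]
    apply Real.lt_sqrt_of_sq_lt
    rw [div_pow, div_lt_div_iff₀ (by positivity) hP]
    nlinarith
  have q1 : 0 < a * w - b := by
    have := (div_lt_iff₀ ha).1 hwb
    linarith
  have q2 : 0 < a - b * w := by nlinarith
  have q3 : 0 < a * w + b := by positivity
  have q4 : 0 < a + b * w := by positivity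
  have e1 : 1 + x = (a - b * w) * (a + b * w) / ((a * w - b) * (a * w + b)) := by
    rw [eq_div_iff (by positivity)]
    have hb2 : b ^ 2 = 1 - a ^ 2 := by linarith
    have : (1 + x) * (a ^ 2 * w ^ 2 - b ^ 2) = a ^ 2 - b ^ 2 * w ^ 2 := by
      rw [hb2] at hw2 ⊢
      linear_combination hw2
    linear_combination this
  have e2 : 1 + x * (b ^ 2 + a * b * w) = w * (a - b * w) / (a * w - b) := by
    rw [eq_div_iff q1.ne']
    have hb2 : b ^ 2 = 1 - a ^ 2 := by linarith
    have e3 : (1 + x) * ((a * w - b) * (a * w + b)) = (a - b * w) * (a + b * w) := by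
      rw [e1]; field_simp
    have hx2 : x * ((a * w - b) * (a * w + b)) = 1 - w ^ 2 := by
      linear_combination e3 + (1 - w ^ 2) * h1
    linear_combination b * hx2
  have hh : 0 < 1 + x * (b ^ 2 + a * b * w) := by positivity
  rw [← Real.log_le_log_iff (by positivity) hh, Real.log_rpow (by positivity), e2, e1,
    Real.log_div (by positivity) (by positivity), Real.log_div (by positivity) q1.ne',
    Real.log_mul q2.ne' q4.ne', Real.log_mul q1.ne' q3.ne', Real.log_mul hw0.ne' q2.ne']
  have := log_threshold_le hb hlt h1 hwb hw1
  linarith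

/-- As a function of `t` this is a quadratic with leading coefficient `a²x`; the bound on `ρ`
controls its discriminant. -/
lemma quadratic_nonneg_of_le {a b x ρ t : ℝ} (h1 : a ^ 2 + b ^ 2 = 1)
    (hx : 0 ≤ x) (hρ : 1 ≤ ρ) (hρx : ρ ≤ 1 + x)
    (hle : ρ ≤ 1 + x * (b ^ 2 + a * b * √((1 + b ^ 2 * x) / (1 + a ^ 2 * x)))) (ht : ρ ≤ t)
    (ha : 0 < a) :
    0 ≤ b ^ 2 * x * t ^ 2 - (1 + b ^ 2 * x) * (t - 1) ^ 2 + (1 + a ^ 2 * x) * (t - ρ) ^ 2 := by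
  have hQ : 0 < 1 + b ^ 2 * x := by positivity
  have hP : 0 < 1 + a ^ 2 * x := by positivity
  have hb2 : b ^ 2 = 1 - a ^ 2 := by linarith
  rcases hx.eq_or_lt with rfl | hx0
  · have : ρ = 1 := by linarith
    subst this
    simp
  have hax : 0 < a ^ 2 * x := by positivity
  -- If `ρ ≥ 1 + b²x`, completing the square settles every `t`. Otherwise the vertex lies to the
  -- left of `ρ`, and the expansion in powers of `t - ρ` has nonnegative coefficients.
  rcases le_or_gt (1 + b ^ 2 * x) ρ with h | h
  · set w := √((1 + b ^ 2 * x) / (1 + a ^ 2 * x)) with hw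
    have hw2 : w ^ 2 * (1 + a ^ 2 * x) = 1 + b ^ 2 * x := by
      rw [hw, Real.sq_sqrt (by positivity)]
      field_simp
    have hs : (ρ - (1 + b ^ 2 * x)) ^ 2 ≤ (x * (a * b * w)) ^ 2 := by
      apply pow_le_pow_left₀ (by linarith)
      linarith
    have hs2 : (1 + a ^ 2 * x) * (ρ - (1 + b ^ 2 * x)) ^ 2 ≤
        x ^ 2 * a ^ 2 * b ^ 2 * (1 + b ^ 2 * x) := by
      have := mul_le_mul_of_nonneg_left hs hP.le
      calc _ ≤ _ := this
        _ = x ^ 2 * a ^ 2 * b ^ 2 * (w ^ 2 * (1 + a ^ 2 * x)) := by ring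
        _ = _ := by rw [hw2]
    have key : (a ^ 2 * x) * (b ^ 2 * x * t ^ 2 - (1 + b ^ 2 * x) * (t - 1) ^ 2
        + (1 + a ^ 2 * x) * (t - ρ) ^ 2) =
        (a ^ 2 * x * t - ((1 + a ^ 2 * x) * ρ - (1 + b ^ 2 * x))) ^ 2 +
        (x ^ 2 * a ^ 2 * b ^ 2 * (1 + b ^ 2 * x)
          - (1 + a ^ 2 * x) * (ρ - (1 + b ^ 2 * x)) ^ 2) := by
      rw [hb2]; ring
    have : 0 ≤ (a ^ 2 * x) * (b ^ 2 * x * t ^ 2 - (1 + b ^ 2 * x) * (t - 1) ^ 2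
        + (1 + a ^ 2 * x) * (t - ρ) ^ 2) := by
      rw [key]
      have := sq_nonneg (a ^ 2 * x * t - ((1 + a ^ 2 * x) * ρ - (1 + b ^ 2 * x)))
      linarith
    exact nonneg_of_mul_nonneg_right this hax
  · have key : b ^ 2 * x * t ^ 2 - (1 + b ^ 2 * x) * (t - 1) ^ 2 + (1 + a ^ 2 * x) * (t - ρ) ^ 2
        = a ^ 2 * x * (t - ρ) ^ 2 + 2 * (1 + b ^ 2 * x - ρ) * (t - ρ) +
          (b ^ 2 * x * ρ ^ 2 - (1 + b ^ 2 * x) * (ρ - 1) ^ 2) := by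
      rw [hb2]; ring
    rw [key]
    have h3 : 0 ≤ b ^ 2 * x * ρ ^ 2 - (1 + b ^ 2 * x) * (ρ - 1) ^ 2 := by
      have hy : 0 ≤ b ^ 2 * x := by positivity
      nlinarith [mul_nonneg (sub_nonneg.2 hρ) (sub_nonneg.2 h.le)]
    have h4 : 0 ≤ (1 + b ^ 2 * x - ρ) * (t - ρ) := mul_nonneg (by linarith) (by linarith)
    have h5 : 0 ≤ a ^ 2 * x * (t - ρ) ^ 2 := by positivity
    linarith

lemma mStar_sq {a b : ℝ} (hb : 0 < b) (ha : 0 < a) (h1 : a ^ 2 + b ^ 2 = 1) (hba : b ≤ a) :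
    mStar (b ^ 2) = (1 + b * (a + b)) / (2 * (b * (a + b))) := by
  have hle : b ^ 2 ≤ 1 / 2 := by nlinarith
  have hs : √(b ^ 2 - (b ^ 2) ^ 2) = a * b := by
    rw [show b ^ 2 - (b ^ 2) ^ 2 = (a * b) ^ 2 by rw [mul_pow]; linear_combination -b ^ 2 * h1]
    exact Real.sqrt_sq (by positivity)
  rw [mStar, if_pos hle, hs, div_eq_div_iff (by positivity) (by positivity)]
  linear_combination -2 * b ^ 2 * h1

/-- For `b ≤ a` the threshold gives `ρ ≤ (ρ^(2m-1))^θ` with `θ = b(a+b)`. For `b > a` the square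
root is at least `1`, so the bracket is at least `a² + b² = 1` and `ρ ≤ ρ^(2m-1)` suffices. -/
lemma le_of_mStar_le {a b m ρ : ℝ} (hb : 0 < b) (ha : 0 < a) (h1 : a ^ 2 + b ^ 2 = 1)
    (hm1 : 1 ≤ m) (hm : mStar (b ^ 2) ≤ m) (hρ : 1 ≤ ρ) :
    ρ ≤ 1 + (ρ ^ (2 * m - 1) - 1) * (b ^ 2 + a * b *
      √((1 + b ^ 2 * (ρ ^ (2 * m - 1) - 1)) / (1 + a ^ 2 * (ρ ^ (2 * m - 1) - 1)))) := by
  have hk : ρ ≤ ρ ^ (2 * m - 1) := by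
    nth_rewrite 1 [← Real.rpow_one ρ]
    exact Real.rpow_le_rpow_of_exponent_le hρ (by linarith)
  have hx : 0 ≤ ρ ^ (2 * m - 1) - 1 := by linarith
  set x := ρ ^ (2 * m - 1) - 1 with hxdef
  rcases le_or_gt b a with hba | hab
  · refine le_trans ?_ (rpow_threshold_le hb hba h1 hx)
    rw [mStar_sq hb ha h1 hba, div_le_iff₀ (by positivity)] at hm
    rw [hxdef, add_sub_cancel, ← Real.rpow_mul (by linarith)]
    nth_rewrite 1 [← Real.rpow_one ρ]
    exact Real.rpow_le_rpow_of_exponent_le hρ (by linarith)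
  · have hs : a / b ≤ √((1 + b ^ 2 * x) / (1 + a ^ 2 * x)) := by
      refine le_trans ?_ (Real.le_sqrt_of_sq_le (x := 1) ?_)
      · rw [div_le_one hb]; exact hab.le
      · rw [one_pow, le_div_iff₀ (by positivity)]
        nlinarith [mul_nonneg hx (mul_pos (sub_pos.2 hab) (add_pos ha hb)).le]
    have h2 : 1 ≤ b ^ 2 + a * b * √((1 + b ^ 2 * x) / (1 + a ^ 2 * x)) := by
      have := mul_le_mul_of_nonneg_left hs (mul_pos ha hb).le
      rw [show a * b * (a / b) = a ^ 2 by field_simp] at this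
      linarith
    nlinarith

/-! ### The two-variable inequality -/

lemma _root_.ConvexOn.three_point {F : ℝ → ℝ} (hF : ConvexOn ℝ Set.univ F) {x y z : ℝ}
    (hxy : x ≤ y) (hyz : y ≤ z) : F y * (z - x) ≤ F x * (z - y) + F z * (y - x) := by
  rcases hxy.eq_or_lt with rfl | h1
  · simp
  rcases hyz.eq_or_lt with rfl | h2
  · simp
  have h := hF.slope_mono_adjacent (Set.mem_univ x) (Set.mem_univ z) h1 h2
  rw [div_le_div_iff₀ (by linarith) (by linarith)] at h
  linarith

/-- Integration of an affine lower bound for `F`, phrased through the antiderivative `-G`. -/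
lemma sub_ge_of_affine_le {G F : ℝ → ℝ} (hG : ∀ s, HasDerivAt G (-F s) s) {α β y z : ℝ}
    (hyz : y ≤ z) (h : ∀ s ∈ Set.Icc y z, α - β * s ≤ F s) :
    α * (z - y) - β * (z ^ 2 - y ^ 2) / 2 ≤ G y - G z := by
  have hd : ∀ s, HasDerivAt (fun s => G s + (α * s - β * s ^ 2 / 2))
      (-F s + (α - β * s)) s := by
    intro s
    have h1 : HasDerivAt (fun s => α * s) α s := by simpa using (hasDerivAt_id s).const_mul α
    have h2 : HasDerivAt (fun s => β * s ^ 2 / 2) (β * s) s := by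
      refine (((hasDerivAt_pow 2 s).const_mul β).div_const 2).congr_deriv ?_
      push_cast
      ring
    exact (hG s).add (h1.sub h2)
  have := antitoneOn_of_hasDerivWithinAt_nonpos (convex_Icc y z)
    (fun s _ => (hd s).continuousAt.continuousWithinAt) (fun s _ => (hd s).hasDerivWithinAt)
    (fun s hs => by linarith [h s (interior_subset hs)])
    (Set.left_mem_Icc.2 hyz) (Set.right_mem_Icc.2 hyz) hyz
  simp only at this
  linarith

lemma sub_le_of_le_affine {G F : ℝ → ℝ} (hG : ∀ s, HasDerivAt G (-F s) s) {α β y z : ℝ}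
    (hyz : y ≤ z) (h : ∀ s ∈ Set.Icc y z, F s ≤ α - β * s) :
    G y - G z ≤ α * (z - y) - β * (z ^ 2 - y ^ 2) / 2 := by
  have hG' : ∀ s, HasDerivAt (fun s => -G s) (-(fun s => -F s) s) s := fun s => (hG s).neg
  have := sub_ge_of_affine_le (α := -α) (β := -β) hG' hyz (fun s hs => by linarith [h s hs])
  linarith

/-- The chord of `F` through `1` and `ρ` lies above `F` between these points and below `F` outside.
As `F ≥ 0`, its positive part can replace `F`, and the resulting integrals are computed exactly. -/
lemma four_point_nonneg {G F : ℝ → ℝ} (hG : ∀ s, HasDerivAt G (-F s) s) (hF0 : ∀ s, 0 ≤ F s)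
    (hFa : Antitone F) (hFc : ConvexOn ℝ Set.univ F) {a b x ρ : ℝ} (h1 : a ^ 2 + b ^ 2 = 1)
    (hx : 0 ≤ x) (hρ : 1 ≤ ρ) (hρx : ρ ≤ 1 + x)
    (hq : ∀ t, ρ ≤ t → 0 ≤ b ^ 2 * x * t ^ 2 - (1 + b ^ 2 * x) * (t - 1) ^ 2
      + (1 + a ^ 2 * x) * (t - ρ) ^ 2) :
    0 ≤ b ^ 2 * x * (G 0 - G 1) - (G 1 - G ρ) + a ^ 2 * x * (G ρ - G (ρ + 1)) := by
  have hbx : 0 ≤ b ^ 2 * x := by positivity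
  have hax : 0 ≤ a ^ 2 * x := by positivity
  have hb2 : b ^ 2 = 1 - a ^ 2 := by linarith
  rcases hρ.eq_or_lt with rfl | hρ1
  · have g1 := sub_ge_of_affine_le (α := 0) (β := 0) hG (zero_le_one) (fun s _ => by simpa using hF0 s)
    have g2 := sub_ge_of_affine_le (α := 0) (β := 0) hG (show (1 : ℝ) ≤ 1 + 1 by norm_num)
      (fun s _ => by simpa using hF0 s)
    have := mul_nonneg hbx (show 0 ≤ G 0 - G 1 by linarith)
    have := mul_nonneg hax (show 0 ≤ G 1 - G (1 + 1) by norm_num at g2 ⊢; linarith)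
    linarith
  have hρ0 : 0 < ρ - 1 := by linarith
  set c := (F 1 - F ρ) / (ρ - 1) with hc
  have hcm : c * (ρ - 1) = F 1 - F ρ := by rw [hc]; field_simp
  have hc0 : 0 ≤ c := div_nonneg (sub_nonneg.2 (hFa hρ)) hρ0.le
  have out1 : ∀ s ∈ Set.Icc (0 : ℝ) 1, F 1 + c - c * s ≤ F s := by
    intro s hs
    have := hFc.three_point hs.2 hρ
    refine le_of_mul_le_mul_right ?_ hρ0
    linear_combination this + (s - 1) * -hcm
  have inn : ∀ s ∈ Set.Icc 1 ρ, F s ≤ F 1 + c - c * s := by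
    intro s hs
    have := hFc.three_point hs.1 hs.2
    refine le_of_mul_le_mul_right ?_ hρ0
    linear_combination this + (s - 1) * hcm
  have out2 : ∀ s, ρ ≤ s → F 1 + c - c * s ≤ F s := by
    intro s hs
    have := hFc.three_point hρ hs
    refine le_of_mul_le_mul_right ?_ hρ0
    linear_combination this + (s - 1) * -hcm
  have i1 := sub_ge_of_affine_le hG zero_le_one out1
  have i2 := sub_le_of_le_affine hG hρ inn
  have hF1 := hF0 1
  have hFρ := hF0 ρ
  rcases hc0.eq_or_lt with h0 | hcp
  · have i3 := sub_ge_of_affine_le hG (show ρ ≤ ρ + 1 by linarith) (fun s hs => out2 s hs.1)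
    rw [← h0] at i1 i2 i3
    have j1 := mul_le_mul_of_nonneg_left i1 hbx
    have j3 := mul_le_mul_of_nonneg_left i3 hax
    have := mul_nonneg hF1 (show 0 ≤ x - (ρ - 1) by linarith)
    rw [hb2] at j1 ⊢
    linarith
  -- The chord is `c(t - s)`; its zero `t` is at least `ρ` because `F ρ ≥ 0`.
  · obtain ⟨t, ht⟩ : ∃ t, F 1 + c = c * t := ⟨(F 1 + c) / c, by field_simp⟩
    have htρ : ρ ≤ t := by
      refine le_of_mul_le_mul_left ?_ hcp
      linarith
    rw [ht] at i1 i2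
    have j1 := mul_le_mul_of_nonneg_left i1 hbx
    rcases le_or_gt t (ρ + 1) with h | h
    · have i3 := sub_ge_of_affine_le hG htρ (fun s hs => out2 s hs.1)
      have i4 := sub_ge_of_affine_le (α := 0) (β := 0) hG h (fun s _ => by simpa using hF0 s)
      rw [ht] at i3
      have j3 := mul_le_mul_of_nonneg_left (show c * t * (t - ρ) - c * (t ^ 2 - ρ ^ 2) / 2 ≤
        G ρ - G (ρ + 1) by linarith) hax
      have := mul_nonneg hcp.le (hq t htρ)
      linarith
    -- Here the chord is positive on the whole range, so the expression is affine in `t` with slope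
    -- `c(x - (ρ - 1)) ≥ 0`; the case `t = ρ + 1` suffices.
    · have i3 := sub_ge_of_affine_le hG (show ρ ≤ ρ + 1 by linarith) (fun s hs => out2 s hs.1)
      rw [ht] at i3
      have j3 := mul_le_mul_of_nonneg_left i3 hax
      have := mul_nonneg hcp.le (hq (ρ + 1) (by linarith))
      have := mul_nonneg hcp.le
        (mul_nonneg (show 0 ≤ x - (ρ - 1) by linarith) (show 0 ≤ t - (ρ + 1) by linarith))
      rw [hb2] at *
      linarith

lemma FMinus3.second_deriv_nonneg {f f₁ f₂ : ℝ → ℝ} (h1 : ∀ x, HasDerivAt f (f₁ x) x)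
    (h2 : ∀ x, HasDerivAt f₁ (f₂ x) x) (hv : ConvexOn ℝ Set.univ f) (x : ℝ) : 0 ≤ f₂ x := by
  have hm : Monotone f₁ := by
    have := hv.monotoneOn_deriv (fun x _ => (h1 x).differentiableAt)
    rw [funext fun x => (h1 x).deriv] at this
    exact monotoneOn_univ.1 this
  rw [← (h2 x).deriv]
  exact hm.deriv_nonneg

lemma weighted_slopes_le {a b m : ℝ} (hb : 0 < b) (ha : 0 < a) (h1 : a ^ 2 + b ^ 2 = 1)
    (hm1 : 1 ≤ m) (hm : mStar (b ^ 2) ≤ m) {f f₁ f₂ : ℝ → ℝ} (hf1 : ∀ x, HasDerivAt f (f₁ x) x)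
    (hf2 : ∀ x, HasDerivAt f₁ (f₂ x) x) (hv : ConvexOn ℝ Set.univ f) (ha2 : Antitone f₂)
    (hv2 : ConvexOn ℝ Set.univ f₂) {x y : ℝ} (hy : 0 < y) (hxy : y ≤ x) :
    a ^ 2 * f₁ (x * (b / a) + y * (b / a)) + b ^ 2 * f₁ (x * (b / a) - y * (a / b))
      - a ^ 2 * f₁ (-(x * (a / b)) + y * (b / a)) - b ^ 2 * f₁ (-(x * (a / b)) - y * (a / b)) ≤
    (x / y) ^ (2 * m - 1) *
      (a ^ 2 * f₁ (x * (b / a) + y * (b / a)) + b ^ 2 * f₁ (-(x * (a / b)) + y * (b / a))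
      - a ^ 2 * f₁ (x * (b / a) - y * (a / b)) - b ^ 2 * f₁ (-(x * (a / b)) - y * (a / b))) := by
  have hρ : 1 ≤ x / y := (one_le_div hy).2 hxy
  have hle := le_of_mStar_le hb ha h1 hm1 hm hρ
  have hk : x / y ≤ (x / y) ^ (2 * m - 1) := by
    nth_rewrite 1 [← Real.rpow_one (x / y)]
    exact Real.rpow_le_rpow_of_exponent_le hρ (by linarith)
  set k := (x / y) ^ (2 * m - 1) with hkdef
  set ρ := x / y with hρdef
  have hx : 0 ≤ k - 1 := by linarith
  have hρx : ρ ≤ 1 + (k - 1) := by linarith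
  -- In the coordinate `s ↦ x₀ + h s` the four values of the weighted sum sit at `0, 1, ρ, ρ + 1`.
  set h := y * (b / a + a / b) with hh
  have hh0 : 0 ≤ h := by positivity
  set x₀ := -(x * (a / b)) - y * (a / b) with hx0
  have hxρ : x = ρ * y := by rw [hρdef]; field_simp
  have hG : ∀ s, HasDerivAt (fun s => -f₁ (x₀ + h * s)) (-(h * f₂ (x₀ + h * s))) s := by
    intro s
    have e : HasDerivAt (fun s => x₀ + h * s) h s := by
      simpa using ((hasDerivAt_id s).const_mul h).const_add x₀
    have := ((hf2 (x₀ + h * s)).comp s e).neg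
    rwa [mul_comm] at this
  have key := four_point_nonneg (F := fun s => h * f₂ (x₀ + h * s)) hG
    (fun s => mul_nonneg hh0 (FMinus3.second_deriv_nonneg hf1 hf2 hv _))
    (fun s t hst => mul_le_mul_of_nonneg_left
      (ha2 (by linarith [mul_le_mul_of_nonneg_left hst hh0])) hh0)
    ?_ h1 hx hρ hρx (fun t ht => quadratic_nonneg_of_le h1 hx hρ hρx hle ht ha)
  · rw [show x₀ + h * 0 = x₀ by ring,
      show x₀ + h * 1 = -(x * (a / b)) + y * (b / a) by rw [hx0, hh]; ring,
      show x₀ + h * ρ = x * (b / a) - y * (a / b) by rw [hx0, hh, hxρ]; ring,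
      show x₀ + h * (ρ + 1) = x * (b / a) + y * (b / a) by rw [hx0, hh, hxρ]; ring] at key
    have hb2 : b ^ 2 = 1 - a ^ 2 := by linarith
    rw [hb2] at key ⊢
    linarith
  · have := (hv2.comp_affineMap (AffineMap.lineMap x₀ (x₀ + h) : ℝ →ᵃ[ℝ] ℝ)).smul hh0
    refine (this.congr fun s _ => ?_)
    simp only [Function.comp_apply, AffineMap.lineMap_apply, vsub_eq_sub, vadd_eq_add,
      smul_eq_mul]
    ring_nf

/-- Square roots of `p` and `1 - p`, and the two values of `bsLaw p` in terms of them. -/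
lemma exists_sqrt_param {p : ℝ} (hp₀ : 0 < p) (hp₁ : p < 1) :
    ∃ a b : ℝ, 0 < a ∧ 0 < b ∧ a ^ 2 + b ^ 2 = 1 ∧ p = a ^ 2 ∧ 1 - p = b ^ 2 ∧
      √((1 - p) / p) = b / a ∧ √(p / (1 - p)) = a / b := by
  have hq : 0 < 1 - p := by linarith
  refine ⟨√p, √(1 - p), Real.sqrt_pos.2 hp₀, Real.sqrt_pos.2 hq, ?_, ?_, ?_, ?_, ?_⟩
  · rw [Real.sq_sqrt hp₀.le, Real.sq_sqrt hq.le]; ring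
  · rw [Real.sq_sqrt hp₀.le]
  · rw [Real.sq_sqrt hq.le]
  · rw [Real.sqrt_div hq.le]
  · rw [Real.sqrt_div hp₀.le]

lemma antitoneOn_bsTwo_rpow {p m : ℝ} (hp₀ : 0 < p) (hp₁ : p < 1) (hm1 : 1 ≤ m)
    (hm : mStar (1 - p) ≤ m) {f : ℝ → ℝ} (hf : f ∈ FMinus3) (σ : ℝ) :
    AntitoneOn (fun τ => bsTwo p f (τ ^ (1 / (2 * m))) ((σ - τ) ^ (1 / (2 * m))))
      (Set.Icc (σ / 2) σ) := by
  obtain ⟨a, b, ha, hb, h1, hpa, hpb, hu, hv'⟩ := exists_sqrt_param hp₀ hp₁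
  obtain ⟨f₁, f₂, hf1, hf2, -, -, hv, ha2, hv2⟩ := mem_FMinus3_iff.1 hf
  rw [hpb] at hm
  set e := 1 / (2 * m) with he
  have he0 : 0 < e := by positivity
  have hfc := FMinus3.continuous hf
  have hexp : (fun τ => bsTwo p f (τ ^ e) ((σ - τ) ^ e)) = fun τ =>
      a ^ 2 * (a ^ 2 * f (τ ^ e * (b / a) + (σ - τ) ^ e * (b / a)) +
        b ^ 2 * f (τ ^ e * (b / a) - (σ - τ) ^ e * (a / b))) +
      b ^ 2 * (a ^ 2 * f (-(τ ^ e * (a / b)) + (σ - τ) ^ e * (b / a)) +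
        b ^ 2 * f (-(τ ^ e * (a / b)) - (σ - τ) ^ e * (a / b))) := by
    funext τ
    simp only [bsTwo, bsAverage, hu, hv', zero_add, zero_sub]
    rw [hpb]
    rw [hpa]
  have hcont : Continuous (fun τ : ℝ => τ ^ e) := Real.continuous_rpow_const he0.le
  rw [hexp]
  refine antitoneOn_of_hasDerivWithinAt_nonpos
    (f' := fun τ => e * (a * b) * (τ ^ (e - 1) *
      (a ^ 2 * f₁ (τ ^ e * (b / a) + (σ - τ) ^ e * (b / a)) +
        b ^ 2 * f₁ (τ ^ e * (b / a) - (σ - τ) ^ e * (a / b)) -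
        a ^ 2 * f₁ (-(τ ^ e * (a / b)) + (σ - τ) ^ e * (b / a)) -
        b ^ 2 * f₁ (-(τ ^ e * (a / b)) - (σ - τ) ^ e * (a / b))) - (σ - τ) ^ (e - 1) *
      (a ^ 2 * f₁ (τ ^ e * (b / a) + (σ - τ) ^ e * (b / a)) +
        b ^ 2 * f₁ (-(τ ^ e * (a / b)) + (σ - τ) ^ e * (b / a)) -
        a ^ 2 * f₁ (τ ^ e * (b / a) - (σ - τ) ^ e * (a / b)) -
        b ^ 2 * f₁ (-(τ ^ e * (a / b)) - (σ - τ) ^ e * (a / b)))))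
    (convex_Icc _ _) ?_ ?_ ?_
  · have hc2 : Continuous (fun τ : ℝ => (σ - τ) ^ e) := hcont.comp (by fun_prop)
    apply Continuous.continuousOn
    fun_prop
  · intro τ hτ
    rw [interior_Icc] at hτ
    have hτ1 : 0 < σ - τ := by linarith [hτ.2]
    have hτ0 : 0 < τ := by linarith [hτ.1, hτ.2]
    have dX : HasDerivAt (fun τ : ℝ => τ ^ e) (e * τ ^ (e - 1)) τ :=
      Real.hasDerivAt_rpow_const (Or.inl hτ0.ne')
    have dY : HasDerivAt (fun τ : ℝ => (σ - τ) ^ e) (-(e * (σ - τ) ^ (e - 1))) τ := by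
      have := (Real.hasDerivAt_rpow_const (p := e) (Or.inl hτ1.ne')).comp τ
        ((hasDerivAt_id τ).const_sub σ)
      simpa [Function.comp_def] using this
    have g1 := (hf1 _).comp τ ((dX.mul_const (b / a)).add (dY.mul_const (b / a)))
    have g2 := (hf1 _).comp τ ((dX.mul_const (b / a)).sub (dY.mul_const (a / b)))
    have g3 := (hf1 _).comp τ ((dX.mul_const (a / b)).neg.add (dY.mul_const (b / a)))
    have g4 := (hf1 _).comp τ ((dX.mul_const (a / b)).neg.sub (dY.mul_const (a / b)))
    have g := (((g1.const_mul (a ^ 2)).add (g2.const_mul (b ^ 2))).const_mul (a ^ 2)).add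
      (((g3.const_mul (a ^ 2)).add (g4.const_mul (b ^ 2))).const_mul (b ^ 2))
    refine (g.congr_deriv ?_).hasDerivWithinAt
    simp only [Pi.add_apply, Pi.sub_apply, Pi.neg_apply]
    field_simp
    ring
  · intro τ hτ
    rw [interior_Icc] at hτ
    have hτ1 : 0 < σ - τ := by linarith [hτ.2]
    have hτ0 : 0 < τ := by linarith [hτ.1, hτ.2]
    have key := weighted_slopes_le hb ha h1 hm1 hm hf1 hf2 hv ha2 hv2
      (x := τ ^ e) (y := (σ - τ) ^ e) (by positivity)
      (Real.rpow_le_rpow hτ1.le (by linarith [hτ.1]) he0.le)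
    -- The power of `x/y` is the ratio of the two chain-rule factors, since `e(2m - 1) = 1 - e`.
    have hk : ((τ ^ e) / ((σ - τ) ^ e)) ^ (2 * m - 1) = (σ - τ) ^ (e - 1) / τ ^ (e - 1) := by
      have h3 : e * (2 * m - 1) = -(e - 1) := by
        rw [he]; field_simp; ring
      rw [← Real.div_rpow hτ0.le hτ1.le, ← Real.rpow_mul (by positivity), h3, Real.rpow_neg
        (by positivity), Real.div_rpow hτ0.le hτ1.le, inv_div]
    rw [hk] at key
    have hpos : 0 < τ ^ (e - 1) := by positivity
    have := mul_le_mul_of_nonneg_left key hpos.le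
    rw [← mul_assoc, mul_div_cancel₀ _ hpos.ne'] at this
    exact mul_nonpos_of_nonneg_of_nonpos (by positivity) (by linarith)

lemma bsTwo_rpow_le {p m : ℝ} (hp₀ : 0 < p) (hp₁ : p < 1) (hm1 : 1 ≤ m)
    (hm : mStar (1 - p) ≤ m) {f : ℝ → ℝ} (hf : f ∈ FMinus3) {x₁ x₂ y₁ y₂ : ℝ}
    (hx : 0 ≤ x₂) (hxy : x₁ + x₂ = y₁ + y₂) (hy : y₂ ≤ y₁) (hle : y₁ ≤ x₁) :
    bsTwo p f (x₁ ^ (1 / (2 * m))) (x₂ ^ (1 / (2 * m))) ≤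
      bsTwo p f (y₁ ^ (1 / (2 * m))) (y₂ ^ (1 / (2 * m))) := by
  have := antitoneOn_bsTwo_rpow hp₀ hp₁ hm1 hm hf (x₁ + x₂)
    (show y₁ ∈ Set.Icc _ _ from ⟨by linarith, by linarith⟩)
    (show x₁ ∈ Set.Icc _ _ from ⟨by linarith, by linarith⟩) hle
  simpa [hxy, show x₁ + x₂ - x₁ = x₂ by ring, show y₁ + y₂ - x₁ = x₂ by linarith] using this

/-! ### Majorization and Schur concavity -/

lemma decreasing_eq_comp {n : ℕ} (a : Fin n → ℝ) :
    decreasing a = fun i => a ((Fin.revPerm.trans (Tuple.sort a)) i) := rfl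

lemma antitone_decreasing {n : ℕ} (a : Fin n → ℝ) : Antitone (decreasing a) :=
  fun _ _ h => Tuple.monotone_sort a (Fin.rev_le_rev.2 h)

lemma sum_decreasing {n : ℕ} (a : Fin n → ℝ) : ∑ i, decreasing a i = ∑ i, a i :=
  Equiv.sum_comp (Fin.revPerm.trans (Tuple.sort a)) a

/-- The Hardy–Littlewood–Pólya argument: each transfer makes one more coordinate agree with `b`.
Only `b` is assumed sorted, as a transfer may spoil the order of `a`. -/
lemma le_of_partial_sums_le {n : ℕ} {Q : (Fin n → ℝ) → ℝ}
    (htr : ∀ (a b : Fin n → ℝ) (i j : Fin n), i ≠ j → (∀ k, k ≠ i → k ≠ j → a k = b k) →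
      (∀ k, 0 ≤ a k) → a i + a j = b i + b j → b j ≤ b i → b i ≤ a i → Q a ≤ Q b)
    {b : Fin n → ℝ} (hb : Antitone b) (N : ℕ) : ∀ a : Fin n → ℝ, (∀ k, 0 ≤ a k) →
      (Finset.univ.filter fun i => a i ≠ b i).card ≤ N → ∑ i, a i = ∑ i, b i →
      (∀ j : Fin n, ∑ i ∈ Finset.Iic j, b i ≤ ∑ i ∈ Finset.Iic j, a i) → Q a ≤ Q b := by
  induction N with
  | zero =>
    intro a _ hN _ _
    have : a = b := by
      funext i
      by_contra hi
      have : i ∈ Finset.univ.filter fun i => a i ≠ b i := by simpa using hi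
      rw [Finset.card_eq_zero.1 (Nat.le_zero.1 hN)] at this
      simp at this
    rw [this]
  | succ N ih =>
    intro a ha hN hsum hpart
    by_cases hab : a = b
    · rw [hab]
    have hex : ∃ k, a k < b k := by
      by_contra! h
      apply hab
      funext i
      exact ((Finset.sum_eq_sum_iff_of_le (fun i _ => h i)).1 hsum.symm i (Finset.mem_univ i)).symm
    obtain ⟨k, hk, hkmin⟩ : ∃ k, a k < b k ∧ ∀ l < k, b l ≤ a l := by
      have hne : (Finset.univ.filter fun k => a k < b k).Nonempty := by
        obtain ⟨k, hk⟩ := hex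
        exact ⟨k, by simpa using hk⟩
      refine ⟨(Finset.univ.filter fun k => a k < b k).min' hne, ?_, ?_⟩
      · simpa using Finset.min'_mem _ hne
      · intro l hl
        by_contra! h
        exact absurd (Finset.min'_le _ l (by simpa using h)) (not_le.2 hl)
    obtain ⟨j, hjk, hj⟩ : ∃ j < k, b j < a j := by
      by_contra! h
      have := hpart k
      refine absurd this (not_le.2 (Finset.sum_lt_sum (fun i hi => ?_) ⟨k, by simp, hk⟩))
      rcases (Finset.mem_Iic.1 hi).lt_or_eq with hlt | rfl
      · exact h i hlt
      · exact hk.le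
    -- The largest amount that overshoots neither target; it makes `j` or `k` agree with `b`.
    set δ := min (a j - b j) (b k - a k) with hδ
    have hδ0 : 0 < δ := lt_min (by linarith) (by linarith)
    have hδ1 : δ ≤ a j - b j := min_le_left _ _
    have hδ2 : δ ≤ b k - a k := min_le_right _ _
    set a' := Function.update (Function.update a j (a j - δ)) k (a k + δ) with ha'
    have hjk' : j ≠ k := hjk.ne
    have ej : a' j = a j - δ := by simp [ha', hjk']
    have ek : a' k = a k + δ := by simp [ha']
    have eo : ∀ l, l ≠ j → l ≠ k → a' l = a l := fun l h1 h2 => by simp [ha', h1, h2]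
    have hform : ∀ l, a' l = a l + ((if l = k then δ else 0) - (if l = j then δ else 0)) := by
      intro l
      by_cases h1 : l = j
      · subst h1; rw [ej]; simp [hjk']; ring
      · by_cases h2 : l = k
        · subst h2; rw [ek]; simp [h1]
        · rw [eo l h1 h2]; simp [h1, h2]
    have hbjk : b k ≤ b j := hb hjk.le
    calc Q a ≤ Q a' := by
          refine htr a a' j k hjk' (fun l h1 h2 => (eo l h1 h2).symm) ha ?_ ?_ ?_
          · rw [ej, ek]; ring
          · rw [ej, ek]; linarith
          · rw [ej]; linarith
      _ ≤ Q b := by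
          refine ih a' ?_ ?_ ?_ ?_
          · intro l
            by_cases h1 : l = j
            · subst h1; rw [ej]; linarith [ha k]
            · by_cases h2 : l = k
              · subst h2; rw [ek]; linarith [ha l]
              · rw [eo l h1 h2]; exact ha l
          · have hsub : (Finset.univ.filter fun i => a' i ≠ b i) ⊂
                (Finset.univ.filter fun i => a i ≠ b i) := by
              rw [Finset.ssubset_iff_of_subset]
              · rcases le_total (a j - b j) (b k - a k) with h | h
                · have e : δ = a j - b j := min_eq_left h
                  refine ⟨j, by simpa using hj.ne', ?_⟩
                  simp [ej, e]
                · have e : δ = b k - a k := min_eq_right h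
                  refine ⟨k, by simpa using hk.ne, ?_⟩
                  simp [ek, e]
              · intro l hl
                simp only [Finset.mem_filter, Finset.mem_univ, true_and] at hl ⊢
                by_cases h1 : l = j
                · subst h1; exact hj.ne'
                · by_cases h2 : l = k
                  · subst h2; exact hk.ne
                  · rwa [eo l h1 h2] at hl
            have := Finset.card_lt_card hsub
            omega
          · rw [← hsum]
            simp [hform, Finset.sum_add_distrib]
          · intro l
            have hs : ∑ i ∈ Finset.Iic l, a' i = ∑ i ∈ Finset.Iic l, a i +
                ((if k ≤ l then δ else 0) - (if j ≤ l then δ else 0)) := by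
              simp [hform, Finset.sum_add_distrib]
            rw [hs]
            by_cases h1 : k ≤ l
            · simpa [h1, hjk.le.trans h1] using hpart l
            · by_cases h2 : j ≤ l
              · simp only [h1, h2, if_true, if_false]
                -- Before `k` no coordinate of `a` is below that of `b`, so the surplus at `j` alone
                -- pays for `δ` in this partial sum.
                have : ∑ i ∈ Finset.Iic l, (if i = j then δ else 0) ≤
                    ∑ i ∈ Finset.Iic l, (a i - b i) := by
                  refine Finset.sum_le_sum fun i hi => ?_
                  split_ifs with hij
                  · subst hij; exact hδ1
                  · linarith [hkmin i ((Finset.mem_Iic.1 hi).trans_lt (not_le.1 h1))]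
                simp [h2] at this
                linarith
              · simpa [h1, h2] using hpart l

lemma schurConcave_of_transfer {n : ℕ} {Q : (Fin n → ℝ) → ℝ}
    (hperm : ∀ (a : Fin n → ℝ) (e : Equiv.Perm (Fin n)), Q (fun i => a (e i)) = Q a)
    (htr : ∀ (a b : Fin n → ℝ) (i j : Fin n), i ≠ j → (∀ k, k ≠ i → k ≠ j → a k = b k) →
      (∀ k, 0 ≤ a k) → a i + a j = b i + b j → b j ≤ b i → b i ≤ a i → Q a ≤ Q b) :
    SchurConcave Q := by
  intro a b ha _ hab
  have hQa : Q (decreasing a) = Q a := by rw [decreasing_eq_comp]; exact hperm a _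
  have hQb : Q (decreasing b) = Q b := by rw [decreasing_eq_comp]; exact hperm b _
  rw [← hQa, ← hQb]
  exact le_of_partial_sums_le htr (antitone_decreasing b) _ _ (fun k => ha _) le_rfl
    (by rw [sum_decreasing, sum_decreasing, hab.1]) hab.2

lemma majorizes_const {n : ℕ} (hn : 0 < n) (a : Fin n → ℝ) :
    Majorizes a (fun _ => 1 / (n : ℝ) * ∑ i, a i) := by
  have hn' : (n : ℝ) ≠ 0 := by positivity
  refine ⟨by simp; field_simp, fun j => ?_⟩
  set M := 1 / (n : ℝ) * ∑ i, a i with hM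
  have hdec : decreasing (fun _ : Fin n => M) = fun _ => M := rfl
  rw [hdec, ← sub_nonneg, ← Finset.sum_sub_distrib]
  have htot : ∑ i, (decreasing a i - M) = 0 := by
    rw [Finset.sum_sub_distrib, sum_decreasing]
    simp only [hM, Finset.sum_const, Finset.card_univ, Fintype.card_fin, nsmul_eq_mul]
    field_simp
    ring
  have hanti := antitone_decreasing a
  rcases le_or_gt M (decreasing a j) with h | h
  · exact Finset.sum_nonneg fun i hi => by linarith [hanti (Finset.mem_Iic.1 hi)]
  · rw [← Finset.sum_add_sum_compl (Finset.Iic j)] at htot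
    have : ∑ i ∈ (Finset.Iic j)ᶜ, (decreasing a i - M) ≤ 0 :=
      Finset.sum_nonpos fun i hi => by
        have : j < i := by simpa using hi
        linarith [hanti this.le]
    linarith

lemma bsTwo_comm (p : ℝ) (f : ℝ → ℝ) (x y : ℝ) : bsTwo p f x y = bsTwo p f y x := by
  simp only [bsTwo, bsAverage]
  rw [add_right_comm 0 (x * _) (y * _), add_sub_right_comm 0 (x * _) (y * _),
    sub_right_comm 0 (x * _) (y * _), ← add_sub_right_comm 0 (y * √((1 - p) / p))]
  ring

lemma bsAverage_bsAverage (p : ℝ) (f : ℝ → ℝ) (x y z : ℝ) :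
    bsAverage p (bsAverage p f x) y z = bsTwo p (fun t => f (t + z)) x y := by
  rw [bsTwo_comm]
  simp only [bsTwo, bsAverage]
  ring_nf

/-- With the remaining summands fixed, their contribution is a translation of `f`, which stays in
the class; the two-variable inequality applies pointwise. -/
lemma bsMoment_transfer {p m : ℝ} (hp₀ : 0 < p) (hp₁ : p < 1) (hm1 : 1 ≤ m)
    (hm : mStar (1 - p) ≤ m) {f : ℝ → ℝ} (hf : f ∈ FMinus3) {n : ℕ} (a b : Fin n → ℝ)
    (i j : Fin n) (hij : i ≠ j) (hab : ∀ k, k ≠ i → k ≠ j → a k = b k) (ha : ∀ k, 0 ≤ a k)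
    (hsum : a i + a j = b i + b j) (hb : b j ≤ b i) (hle : b i ≤ a i) :
    bsMoment p f (fun k => a k ^ (1 / (2 * m))) ≤ bsMoment p f (fun k => b k ^ (1 / (2 * m))) := by
  obtain ⟨n, rfl⟩ : ∃ l, n = l + 2 := by
    have h1 := i.isLt
    have h2 := j.isLt
    have h3 : (i : ℕ) ≠ j := fun h => hij (Fin.ext h)
    exact ⟨n - 2, by omega⟩
  obtain ⟨j', rfl⟩ := Fin.exists_succAbove_eq hij.symm
  have hfc := FMinus3.continuous hf
  rw [bsMoment_succAbove hp₀ hp₁ hfc _ i,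
    bsMoment_succAbove hp₀ hp₁ (continuous_bsAverage hfc _) _ j',
    bsMoment_succAbove hp₀ hp₁ hfc (fun k => b k ^ _) i,
    bsMoment_succAbove hp₀ hp₁ (continuous_bsAverage hfc _) _ j']
  have hrest : ∀ l, a (i.succAbove (j'.succAbove l)) = b (i.succAbove (j'.succAbove l)) :=
    fun l => hab _ (Fin.succAbove_ne _ _) fun h =>
      Fin.succAbove_ne _ _ (Fin.succAbove_right_injective h)
  simp only [hrest]
  refine bsMoment_mono hp₀ hp₁ (continuous_bsAverage (continuous_bsAverage hfc _) _)
    (continuous_bsAverage (continuous_bsAverage hfc _) _) (fun z => ?_) _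
  rw [bsAverage_bsAverage, bsAverage_bsAverage]
  exact bsTwo_rpow_le hp₀ hp₁ hm1 hm (FMinus3.comp_add_const hf z) (ha _) hsum hb hle

lemma schurConcave_bsMoment {p m : ℝ} (hp₀ : 0 < p) (hp₁ : p < 1) (hm1 : 1 ≤ m)
    (hm : mStar (1 - p) ≤ m) {f : ℝ → ℝ} (hf : f ∈ FMinus3) (n : ℕ) :
    SchurConcave (fun a : Fin n → ℝ => bsMoment p f (fun i => a i ^ (1 / (2 * m)))) :=
  schurConcave_of_transfer
    (fun a e => bsMoment_comp_perm hp₀ hp₁ (FMinus3.continuous hf)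
      (fun i => a i ^ (1 / (2 * m))) e)
    (bsMoment_transfer hp₀ hp₁ hm1 hm hf)

lemma bsMoment_le_of_schurConcave {p m : ℝ} (hm1 : 1 ≤ m) {f : ℝ → ℝ} {n : ℕ} (hn : 0 < n)
    (h : SchurConcave (fun a : Fin n → ℝ => bsMoment p f (fun i => a i ^ (1 / (2 * m)))))
    (c : Fin n → ℝ) (hc : ∀ i, 0 ≤ c i) :
    bsMoment p f c ≤ bsMoment p f (fun _ : Fin n => powerMean m c) := by
  have h1 : ∀ i, 0 ≤ c i ^ (2 * m) := fun i => Real.rpow_nonneg (hc i) _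
  have := h (fun i => c i ^ (2 * m)) (fun _ => 1 / (n : ℝ) * ∑ i, c i ^ (2 * m)) h1
    (fun _ => mul_nonneg (by positivity) (Finset.sum_nonneg fun i _ => h1 i))
    (majorizes_const hn _)
  have e : ∀ i, (c i ^ (2 * m)) ^ (1 / (2 * m)) = c i := fun i => by
    rw [← Real.rpow_mul (hc i), mul_one_div_cancel (by positivity), Real.rpow_one]
  simpa only [e, powerMean] using this

/-! ### Monotonicity in the scale -/

lemma le_bsAverage {p : ℝ} (hp₀ : 0 < p) (hp₁ : p < 1) {f : ℝ → ℝ}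
    (hf : ConvexOn ℝ Set.univ f) (c y : ℝ) : f y ≤ bsAverage p f c y := by
  obtain ⟨a, b, ha, hb, h1, hpa, hpb, hu, hv⟩ := exists_sqrt_param hp₀ hp₁
  have := hf.2 (Set.mem_univ (y + c * (b / a))) (Set.mem_univ (y - c * (a / b)))
    (sq_nonneg a) (sq_nonneg b) h1
  rw [bsAverage, hu, hv, hpb, hpa]
  refine le_trans (le_of_eq ?_) this
  congr 1
  simp only [smul_eq_mul]
  field_simp
  linear_combination -y * h1

lemma bsAverage_mono_scale {p : ℝ} (hp₀ : 0 < p) (hp₁ : p < 1) {f : ℝ → ℝ}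
    (hf : ConvexOn ℝ Set.univ f) {c d : ℝ} (hc : 0 ≤ c) (hcd : c ≤ d) (y : ℝ) :
    bsAverage p f c y ≤ bsAverage p f d y := by
  rcases hc.eq_or_lt with rfl | hc0
  · have : bsAverage p f 0 y = f y := by simp only [bsAverage]; ring_nf
    rw [this]
    exact le_bsAverage hp₀ hp₁ hf d y
  have hd : 0 < d := hc0.trans_le hcd
  have hl := le_bsAverage hp₀ hp₁ hf d y
  have h0 : 0 ≤ 1 - c / d := by rw [sub_nonneg, div_le_one hd]; exact hcd
  have h1 : 0 ≤ c / d := by positivity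
  have i1 := hf.2 (Set.mem_univ y) (Set.mem_univ (y + d * √((1 - p) / p))) h0 h1 (by ring)
  have i2 := hf.2 (Set.mem_univ y) (Set.mem_univ (y - d * √(p / (1 - p)))) h0 h1 (by ring)
  simp only [smul_eq_mul] at i1 i2
  rw [show (1 - c / d) * y + c / d * (y + d * √((1 - p) / p)) = y + c * √((1 - p) / p) by
    field_simp; ring] at i1
  rw [show (1 - c / d) * y + c / d * (y - d * √(p / (1 - p))) = y - c * √(p / (1 - p)) by
    field_simp; ring] at i2
  have j1 := mul_le_mul_of_nonneg_left i1 hp₀.le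
  have j2 := mul_le_mul_of_nonneg_left i2 (sub_nonneg.2 hp₁.le)
  have j3 := mul_le_mul_of_nonneg_left hl h0
  unfold bsAverage at *
  linarith

lemma bsTwo_mono_scale {p : ℝ} (hp₀ : 0 < p) (hp₁ : p < 1) {f : ℝ → ℝ} (hf : f ∈ FMinus3)
    {c d : ℝ} (hc : 0 ≤ c) (hcd : c ≤ d) : bsTwo p f c c ≤ bsTwo p f d d := by
  have h1 : bsTwo p f c c ≤ bsTwo p f d c :=
    bsAverage_mono_scale hp₀ hp₁ (FMinus3.bsAverage hp₀ hp₁ hf c).2.2.1 hc hcd 0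
  have h2 : bsTwo p f d c ≤ bsTwo p f d d := by
    rw [bsTwo_comm]
    exact bsAverage_mono_scale hp₀ hp₁ (FMinus3.bsAverage hp₀ hp₁ hf d).2.2.1 hc hcd 0
  exact h1.trans h2

/-! ### Necessity of the threshold -/

lemma hasDerivAt_max_zero_pow (k : ℕ) (y : ℝ) :
    HasDerivAt (fun y : ℝ => max y 0 ^ (k + 2)) ((k + 2) * max y 0 ^ (k + 1)) y := by
  have hp : HasDerivAt (fun y : ℝ => y ^ (k + 2)) ((k + 2) * y ^ (k + 1)) y := by
    simpa using hasDerivAt_pow (k + 2) y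
  rcases lt_trichotomy y 0 with h | rfl | h
  · rw [max_eq_right h.le, zero_pow (by omega), mul_zero]
    refine (hasDerivAt_const y (0 : ℝ)).congr_of_eventuallyEq ?_
    filter_upwards [Iio_mem_nhds h] with x hx
    rw [max_eq_right (le_of_lt hx), zero_pow (by omega)]
  · rw [← hasDerivWithinAt_univ, ← Set.Iic_union_Ici (a := (0 : ℝ))]
    refine HasDerivWithinAt.union ?_ ?_
    · rw [max_self, zero_pow (by omega), mul_zero]
      refine (hasDerivWithinAt_const (0 : ℝ) _ (0 : ℝ)).congr (fun x hx => ?_) (by simp)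
      rw [max_eq_right hx, zero_pow (by omega)]
    · rw [max_self]
      refine hp.hasDerivWithinAt.congr (fun x hx => ?_) (by simp)
      rw [max_eq_left hx]
  · rw [max_eq_left h.le]
    refine hp.congr_of_eventuallyEq ?_
    filter_upwards [Ioi_mem_nhds h] with x hx
    rw [max_eq_left (le_of_lt hx)]

lemma convexOn_max_sub (t : ℝ) : ConvexOn ℝ Set.univ (fun x : ℝ => max (t - x) 0) := by
  have h1 : ConvexOn ℝ Set.univ (fun x : ℝ => t - x) :=
    (convexOn_const t convex_univ).sub (concaveOn_id convex_univ)
  exact h1.sup (convexOn_const 0 convex_univ)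

lemma max_sub_cube_mem (t : ℝ) : (fun x : ℝ => max (t - x) 0 ^ 3) ∈ FMinus3 := by
  have hsub : ∀ x : ℝ, HasDerivAt (fun x => t - x) (-1) x := fun x => by
    simpa using (hasDerivAt_id x).const_sub t
  have hanti : ∀ x y : ℝ, x ≤ y → max (t - y) 0 ≤ max (t - x) 0 := fun x y h =>
    max_le_max (by linarith) le_rfl
  refine mem_FMinus3_iff.2 ⟨fun x => -3 * max (t - x) 0 ^ 2, fun x => 6 * max (t - x) 0,
    fun x => ?_, fun x => ?_, by fun_prop,
    fun x y h => pow_le_pow_left₀ (le_max_right _ _) (hanti x y h) 3, ?_,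
    fun x y h => by simpa using hanti x y h, (convexOn_max_sub t).smul (by norm_num)⟩
  · have := (hasDerivAt_max_zero_pow 1 (t - x)).comp x (hsub x)
    refine this.congr_deriv ?_
    push_cast
    ring
  · have := ((hasDerivAt_max_zero_pow 0 (t - x)).comp x (hsub x)).const_mul (-3)
    refine this.congr_deriv ?_
    push_cast
    ring
  · exact (convexOn_max_sub t).pow (fun x _ => le_max_right _ _) 3

-- Second-derivative test: the difference vanishes to first order at `0` and has second derivative
-- `4m(M - (2m - 1)) > 0` there.
open Filter Topology in
lemma eventually_rpow_add_rpow_le {m M : ℝ} (hm1 : 1 ≤ m) (hM : 2 * m - 1 < M) :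
    ∀ᶠ ε in 𝓝 (0 : ℝ), (1 + ε) ^ (2 * m) + (1 - ε) ^ (2 * m) ≤ 2 + 2 * m * M * ε ^ 2 := by
  set D : ℝ → ℝ := fun ε => 2 + 2 * m * M * ε ^ 2 - ((1 + ε) ^ (2 * m) + (1 - ε) ^ (2 * m))
  have hpow : ∀ r : ℝ, 1 ≤ r → ∀ ε : ℝ,
      HasDerivAt (fun ε : ℝ => (1 + ε) ^ r) (r * (1 + ε) ^ (r - 1)) ε ∧
      HasDerivAt (fun ε : ℝ => (1 - ε) ^ r) (-(r * (1 - ε) ^ (r - 1))) ε := by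
    intro r hr ε
    have h1 := (Real.hasDerivAt_rpow_const (x := 1 + ε) (p := r) (Or.inr hr)).comp ε
      ((hasDerivAt_id ε).const_add 1)
    have h2 := (Real.hasDerivAt_rpow_const (x := 1 - ε) (p := r) (Or.inr hr)).comp ε
      ((hasDerivAt_id ε).const_sub 1)
    constructor
    · simpa [Function.comp_def] using h1
    · simpa [Function.comp_def] using h2
  have hd1 : ∀ ε, HasDerivAt D (4 * m * M * ε - (2 * m * (1 + ε) ^ (2 * m - 1) +
      -(2 * m * (1 - ε) ^ (2 * m - 1)))) ε := by
    intro ε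
    obtain ⟨h1, h2⟩ := hpow (2 * m) (by linarith) ε
    refine ((((hasDerivAt_pow 2 ε).const_mul (2 * m * M)).const_add 2).sub
      (h1.add h2)).congr_deriv ?_
    push_cast
    ring
  have hd2 : HasDerivAt (deriv D) (4 * m * M - (2 * m * (2 * m - 1) + 2 * m * (2 * m - 1))) 0 := by
    rw [funext fun ε => (hd1 ε).deriv]
    obtain ⟨h1, h2⟩ := hpow (2 * m - 1) (by linarith) 0
    refine (((hasDerivAt_id (0 : ℝ)).const_mul (4 * m * M)).sub
      ((h1.const_mul (2 * m)).add (h2.const_mul (2 * m)).neg)).congr_deriv ?_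
    simp
    ring
  have hmin : IsLocalMin D 0 := by
    refine isLocalMin_of_deriv_deriv_pos ?_ ?_ (hd1 0).continuousAt
    · rw [hd2.deriv]
      nlinarith
    · rw [(hd1 0).deriv]; simp
  filter_upwards [hmin] with ε hε
  have h0 : D 0 = 0 := by simp [D]; norm_num
  rw [h0] at hε
  simp only [D] at hε
  linarith

lemma powerMean_two_le {m M ε : ℝ} (hm1 : 1 ≤ m) (hM : 0 ≤ M)
    (h1 : 0 ≤ 1 + ε) (h2 : 0 ≤ 1 - ε)
    (h : (1 + ε) ^ (2 * m) + (1 - ε) ^ (2 * m) ≤ 2 + 2 * m * M * ε ^ 2) :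
    powerMean m ![1 + ε, 1 - ε] ≤ 1 + M * ε ^ 2 / 2 := by
  have hη : 0 ≤ M * ε ^ 2 / 2 := by positivity
  have hb := one_add_mul_self_le_rpow_one_add (s := M * ε ^ 2 / 2) (by linarith)
    (show 1 ≤ 2 * m by linarith)
  have hn : 0 ≤ (1 + ε) ^ (2 * m) + (1 - ε) ^ (2 * m) := by positivity
  have hle : 1 / 2 * ((1 + ε) ^ (2 * m) + (1 - ε) ^ (2 * m)) ≤
      (1 + M * ε ^ 2 / 2) ^ (2 * m) := by linarith
  have := Real.rpow_le_rpow (by positivity) hle (show 0 ≤ 1 / (2 * m) by positivity)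
  rw [← Real.rpow_mul (by positivity), mul_one_div_cancel (by positivity), Real.rpow_one] at this
  simpa [powerMean] using this

-- Positive coefficients suffice in the hypothesis, so it also follows from the statement on
-- independent variables, whose bounds must be strictly positive.
open Filter Topology in
lemma mStar_le_of_bsMoment_le {p m : ℝ} (hp₀ : 0 < p) (hp₁ : p < 1) (hm1 : 1 ≤ m)
    (H : ∀ f ∈ FMinus3, ∀ c : Fin 2 → ℝ, (∀ i, 0 < c i) →
      bsMoment p f c ≤ bsMoment p f (fun _ : Fin 2 => powerMean m c)) :
    mStar (1 - p) ≤ m := by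
  obtain ⟨a, b, ha, hb, h1, hpa, hpb, hu, hv⟩ := exists_sqrt_param hp₀ hp₁
  rw [hpb]
  rcases lt_or_ge a b with hab | hba
  · have : mStar (b ^ 2) = 1 := by
      rw [mStar, if_neg]
      push Not
      nlinarith
    rwa [this]
  by_contra! hlt
  rw [mStar_sq hb ha h1 hba, lt_div_iff₀ (by positivity)] at hlt
  have hθ : 0 < b * (a + b) := by positivity
  have hba' : b < a := by
    refine lt_of_le_of_ne hba ?_
    rintro rfl
    nlinarith
  -- Below the threshold there is room for `M`: the power mean of `1 ± ε` is at most `1 + Mε²/2` for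
  -- small `ε`, yet `M` times `b(a+b)` is still less than `1`.
  obtain ⟨M, hM1, hM2⟩ := exists_between (show 2 * m - 1 < 1 / (b * (a + b)) by
    rw [lt_div_iff₀ hθ]; linarith)
  have hM0 : 0 < M := by linarith
  rw [lt_div_iff₀ hθ] at hM2
  set u := b / a with hud
  set v := a / b with hvd
  set T := 1 / a ^ 2 with hTd
  have hu0 : 0 < u := by positivity
  have hv0 : 0 < v := by positivity
  have hT0 : 0 < T := by positivity
  have huv : u < v := by
    rw [hud, hvd, div_lt_div_iff₀ ha hb]
    nlinarith
  have hw : u + v = 1 / (a * b) := by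
    rw [hud, hvd]; field_simp; linear_combination h1
  have hTw : T < u + v := by
    rw [hw, hTd]
    apply one_div_lt_one_div_of_lt (by positivity)
    nlinarith
  -- At `ε = 0` the distances from the cutoff down to the three values of the sum are `T - u - v <
  -- 0`, `T` and `T + u + v`, so the top value drops out. The choice `T = 1/a²` minimizes the ratio
  -- of the `η`-coefficient on the right to the `ε²/2`-coefficient on the left, and the minimum is
  -- `b(a+b)`.
  set f : ℝ → ℝ := fun x => max (T + u - v - x) 0 ^ 3 with hf
  have hfm : f ∈ FMinus3 := max_sub_cube_mem _
  have htwo : ∀ x y, bsTwo p f x y = a ^ 2 * (a ^ 2 * f (x * u + y * u) +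
      b ^ 2 * f (x * u - y * v)) + b ^ 2 * (a ^ 2 * f (y * u - x * v) +
        b ^ 2 * f (-(x * v) - y * v)) := by
    intro x y
    simp only [bsTwo, bsAverage, hu, hv, zero_add, zero_sub]
    rw [hpb, ← hpa, neg_add_eq_sub]
  have hsmall : ∀ᶠ ε in 𝓝[>] (0 : ℝ), 12 * a ^ 2 * b ^ 2 * T * (u + v) ^ 2 / M ≤
      (6 * b ^ 4 * v * (T + u + v) ^ 2 - 6 * a ^ 2 * b ^ 2 * T ^ 2 * (u - v)) +
      (12 * b ^ 4 * v ^ 2 * (T + u + v) + 6 * a ^ 2 * b ^ 2 * T * (u - v) ^ 2)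
        * (M * ε ^ 2 / 2) +
      (8 * b ^ 4 * v ^ 3 - 2 * a ^ 2 * b ^ 2 * (u - v) ^ 3) * (M * ε ^ 2 / 2) ^ 2 := by
    have e1 := (eventually_rpow_add_rpow_le hm1 hM1).filter_mono
      (nhdsWithin_le_nhds (s := Set.Ioi 0))
    have e2 : ∀ᶠ ε in 𝓝[>] (0 : ℝ), ε < 1 :=
      nhdsWithin_le_nhds (Iio_mem_nhds one_pos)
    have e3 : ∀ᶠ ε in 𝓝[>] (0 : ℝ), ε < T / (u + v) :=
      nhdsWithin_le_nhds (Iio_mem_nhds (by positivity))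
    filter_upwards [e1, e2, e3, self_mem_nhdsWithin] with ε he1 he2 he3 he0
    have he0 : 0 < ε := he0
    rw [lt_div_iff₀ (by positivity)] at he3
    have hle := H f hfm ![1 + ε, 1 - ε] (by
      intro i
      fin_cases i
      · simp; linarith
      · simpa using he2)
    rw [bsMoment_two hp₀ hp₁ (FMinus3.continuous hfm),
      bsMoment_two hp₀ hp₁ (FMinus3.continuous hfm)] at hle
    simp only [Matrix.cons_val_zero, Matrix.cons_val_one] at hle
    have hs := powerMean_two_le hm1 hM0.le (by linarith) (by linarith) he1
    have hs0 : 0 ≤ powerMean m ![1 + ε, 1 - ε] := by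
      unfold powerMean
      apply Real.rpow_nonneg
      refine mul_nonneg (by positivity) (Finset.sum_nonneg fun i _ => Real.rpow_nonneg ?_ _)
      fin_cases i
      · simp; linarith
      · simpa using he2.le
    have hle2 := hle.trans (bsTwo_mono_scale hp₀ hp₁ hfm hs0 hs)
    set η := M * ε ^ 2 / 2 with hη
    have hη0 : 0 < η := by positivity
    have hε2 : ε ^ 2 = 2 * η / M := by rw [hη]; field_simp
    rw [htwo, htwo] at hle2
    have hηuv : (u - v) * η < 0 := mul_neg_of_neg_of_pos (by linarith) hη0
    have fpos : ∀ x z, T + u - v - x = z → 0 ≤ z → f x = z ^ 3 := fun x z h hz => by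
      simp only [hf, h, max_eq_left hz]
    have fneg : ∀ x, T + u - v - x ≤ 0 → f x = 0 := fun x h => by
      simp only [hf, max_eq_right h]; norm_num
    rw [fneg ((1 + ε) * u + (1 - ε) * u) (by linarith),
      fpos ((1 + ε) * u - (1 - ε) * v) (T - ε * (u + v)) (by ring) (by linarith),
      fpos ((1 - ε) * u - (1 + ε) * v) (T + ε * (u + v)) (by ring) (by positivity),
      fpos (-((1 + ε) * v) - (1 - ε) * v) (T + u + v) (by ring) (by positivity),
      fneg ((1 + η) * u + (1 + η) * u) (by nlinarith),
      fpos ((1 + η) * u - (1 + η) * v) (T - (u - v) * η) (by ring) (by linarith),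
      fpos (-((1 + η) * v) - (1 + η) * v) (T + u + v + 2 * v * η) (by ring) (by positivity)]
      at hle2
    refine le_of_mul_le_mul_right ?_ hη0
    have e4 : 12 * a ^ 2 * b ^ 2 * T * (u + v) ^ 2 / M * η =
        6 * a ^ 2 * b ^ 2 * T * (u + v) ^ 2 * ε ^ 2 := by
      rw [hε2]; ring
    rw [e4]
    linarith
  have hlim : Tendsto (fun ε : ℝ =>
      (6 * b ^ 4 * v * (T + u + v) ^ 2 - 6 * a ^ 2 * b ^ 2 * T ^ 2 * (u - v)) +
      (12 * b ^ 4 * v ^ 2 * (T + u + v) + 6 * a ^ 2 * b ^ 2 * T * (u - v) ^ 2)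
        * (M * ε ^ 2 / 2) +
      (8 * b ^ 4 * v ^ 3 - 2 * a ^ 2 * b ^ 2 * (u - v) ^ 3) * (M * ε ^ 2 / 2) ^ 2) (𝓝[>] 0)
      (𝓝 (6 * b ^ 4 * v * (T + u + v) ^ 2 - 6 * a ^ 2 * b ^ 2 * T ^ 2 * (u - v))) := by
    refine (Continuous.tendsto' (by fun_prop) _ _ (by simp)).mono_left nhdsWithin_le_nhds
  have hfin := ge_of_tendsto hlim hsmall
  have hC0 : 12 * a ^ 2 * b ^ 2 * T * (u + v) ^ 2 / M = 12 / a ^ 2 * (1 / M) := by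
    rw [hw, hTd]; field_simp
  have hC1 : 6 * b ^ 4 * v * (T + u + v) ^ 2 - 6 * a ^ 2 * b ^ 2 * T ^ 2 * (u - v) =
      12 / a ^ 2 * (b * (a + b)) := by
    rw [add_assoc T, hw, hTd, hud, hvd]
    field_simp
    ring
  rw [hC0, hC1] at hfin
  have := le_of_mul_le_mul_left hfin (by positivity)
  rw [div_le_iff₀ hM0] at this
  linarith

/-! ### Two-point laws -/

/-- Rolle twice gives a zero of `e₂` to the left of a zero `t` of `e₁`, with `t < x₂`. Beyond `t`
both `e₁` and the slope of `e` are therefore nonpositive. -/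
lemma nonpos_of_three_zeros {e e₁ e₂ : ℝ → ℝ} (h1 : ∀ x, HasDerivAt e (e₁ x) x)
    (h2 : ∀ x, HasDerivAt e₁ (e₂ x) x) (ha : Antitone e₂) {x₀ x₁ x₂ x₃ : ℝ} (h01 : x₀ < x₁)
    (h12 : x₁ < x₂) (h23 : x₂ ≤ x₃) (z0 : e x₀ = 0) (z1 : e x₁ = 0) (z2 : e x₂ = 0) :
    e x₃ ≤ 0 := by
  have c1 : Continuous e := continuous_iff_continuousAt.2 fun x => (h1 x).continuousAt
  have c2 : Continuous e₁ := continuous_iff_continuousAt.2 fun x => (h2 x).continuousAt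
  obtain ⟨s, hs, hs0⟩ := exists_hasDerivAt_eq_zero h01 c1.continuousOn (z0.trans z1.symm)
    (fun x _ => h1 x)
  obtain ⟨t, ht, ht0⟩ := exists_hasDerivAt_eq_zero h12 c1.continuousOn (z1.trans z2.symm)
    (fun x _ => h1 x)
  obtain ⟨r, hr, hr0⟩ := exists_hasDerivAt_eq_zero (hs.2.trans ht.1) c2.continuousOn
    (hs0.trans ht0.symm) (fun x _ => h2 x)
  have hanti1 : AntitoneOn e₁ (Set.Ici t) :=
    antitoneOn_of_hasDerivWithinAt_nonpos (convex_Ici t) c2.continuousOn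
      (fun x _ => (h2 x).hasDerivWithinAt) fun x hx => by
        rw [← hr0]
        exact ha (hr.2.le.trans (interior_subset hx))
  have hanti : AntitoneOn e (Set.Ici t) :=
    antitoneOn_of_hasDerivWithinAt_nonpos (convex_Ici t) c1.continuousOn
      (fun x _ => (h1 x).hasDerivWithinAt) fun x hx => by
        rw [← ht0]
        exact hanti1 Set.self_mem_Ici (interior_subset hx) (interior_subset hx)
  rw [← z2]
  exact hanti (Set.mem_Ici.2 ht.2.le) (Set.mem_Ici.2 (ht.2.le.trans h23)) h23

/-- Among centred two-point laws of equal variance, a larger left endpoint increases `E f`. -/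
lemma two_point_le_two_point {f : ℝ → ℝ} (hf : f ∈ FMinus3) {A B A' B' y : ℝ} (hA : 0 < A)
    (hB' : 0 < B') (hAA : A ≤ A') (hBB : B' ≤ B) (hvar : A * B = A' * B') :
    (B * f (y - A) + A * f (y + B)) / (A + B) ≤
      (B' * f (y - A') + A' * f (y + B')) / (A' + B') := by
  obtain ⟨f₁, f₂, h1, h2, -, -, -, ha2, -⟩ := mem_FMinus3_iff.1 hf
  have hA' : 0 < A' := hA.trans_le hAA
  have hB : 0 < B := hB'.trans_le hBB
  rcases hAA.eq_or_lt with rfl | hlt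
  · have : B = B' := mul_left_cancel₀ hA.ne' hvar
    rw [this]
  set x₀ := y - A' with hx0
  set x₁ := y - A with hx1
  set x₂ := y + B' with hx2
  set x₃ := y + B with hx3
  have l01 : x₀ < x₁ := by linarith
  have l12 : x₁ < x₂ := by linarith
  -- Quadratic interpolation of `f` at `x₀, x₁, x₂`. The two laws give the quadratic the same mean,
  -- and `f` can differ from it only at `x₃`, where it lies below.
  set d := (f x₁ - f x₀) / (x₁ - x₀) with hd
  set k := (f x₂ - f x₀ - d * (x₂ - x₀)) / ((x₂ - x₀) * (x₂ - x₁)) with hk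
  set e : ℝ → ℝ := fun x => f x - (f x₀ + d * (x - x₀) + k * ((x - x₀) * (x - x₁))) with he
  have z0 : e x₀ = 0 := by simp [he]
  have n10 : x₁ - x₀ ≠ 0 := by linarith
  have n20 : x₂ - x₀ ≠ 0 := by linarith
  have n21 : x₂ - x₁ ≠ 0 := by linarith
  have z1 : e x₁ = 0 := by
    have : d * (x₁ - x₀) = f x₁ - f x₀ := div_mul_cancel₀ _ n10
    simp only [he, this]; ring
  have z2 : e x₂ = 0 := by
    have : k * ((x₂ - x₀) * (x₂ - x₁)) = f x₂ - f x₀ - d * (x₂ - x₀) :=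
      div_mul_cancel₀ _ (mul_ne_zero n20 n21)
    simp only [he, this]; ring
  have he1 : ∀ x, HasDerivAt e (f₁ x - (d + k * (2 * x - x₀ - x₁))) x := by
    intro x
    have i0 := (hasDerivAt_id x).sub_const x₀
    have i1 := (hasDerivAt_id x).sub_const x₁
    refine ((h1 x).sub (((i0.const_mul d).const_add (f x₀)).add
      ((i0.mul i1).const_mul k))).congr_deriv ?_
    simp only [id]
    ring
  have he2 : ∀ x, HasDerivAt (fun x => f₁ x - (d + k * (2 * x - x₀ - x₁))) (f₂ x - 2 * k) x := by
    intro x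
    refine ((h2 x).sub ((((((hasDerivAt_id x).const_mul 2).sub_const x₀).sub_const
      x₁).const_mul k).const_add d)).congr_deriv ?_
    ring
  have h3 := nonpos_of_three_zeros he1 he2 (fun x y h => sub_le_sub_right (ha2 h) _) l01 l12
    (show x₂ ≤ x₃ by linarith) z0 z1 z2
  have f1 : f x₁ = f x₀ + d * (x₁ - x₀) + k * ((x₁ - x₀) * (x₁ - x₁)) := by
    simp only [he] at z1; linarith
  have f2 : f x₂ = f x₀ + d * (x₂ - x₀) + k * ((x₂ - x₀) * (x₂ - x₁)) := by
    simp only [he] at z2; linarith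
  have f3 : f x₃ ≤ f x₀ + d * (x₃ - x₀) + k * ((x₃ - x₀) * (x₃ - x₁)) := by
    simp only [he] at h3; linarith
  have hR : (B' * f x₀ + A' * f x₂) / (A' + B') =
      f x₀ + d * A' + k * (A' * B' + A' * A) := by
    rw [div_eq_iff (by positivity), f2, hx0, hx1, hx2]
    ring
  rw [hR, div_le_iff₀ (by positivity), ← hvar]
  have := mul_le_mul_of_nonneg_left f3 hA.le
  rw [f1]
  have e3 : (f x₀ + d * A' + k * (A * B + A' * A)) * (A + B) =
      B * (f x₀ + d * (x₁ - x₀) + k * ((x₁ - x₀) * (x₁ - x₁))) +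
      A * (f x₀ + d * (x₃ - x₀) + k * ((x₃ - x₀) * (x₃ - x₁))) := by
    rw [hx0, hx1, hx3]
    ring
  rw [e3]
  linarith

lemma two_point_le_bsAverage {p : ℝ} (hp₀ : 0 < p) (hp₁ : p < 1) {f : ℝ → ℝ} (hf : f ∈ FMinus3)
    {A B c : ℝ} (hA : 0 < A) (hB : 0 < B) (hc : √(A * B) ≤ c) (hAB : A / B ≤ p / (1 - p))
    (y : ℝ) : (B * f (y - A) + A * f (y + B)) / (A + B) ≤ bsAverage p f c y := by
  refine le_trans ?_ (bsAverage_mono_scale hp₀ hp₁ hf.2.2.1 (Real.sqrt_nonneg _) hc y)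
  obtain ⟨a, b, ha, hb, h1, hpa, hpb, hu, hv⟩ := exists_sqrt_param hp₀ hp₁
  set s := √(A * B) with hs
  have hs0 : 0 < s := Real.sqrt_pos.2 (by positivity)
  have hs2 : s ^ 2 = A * B := Real.sq_sqrt (by positivity)
  rw [hpa, ← hpa, hpb, hpa, div_le_div_iff₀ hB (by positivity)] at hAB
  have hAA : A ≤ s * (a / b) := by
    refine le_of_sq_le_sq ?_ (by positivity)
    rw [mul_pow, hs2, div_pow, mul_div_assoc', le_div_iff₀ (by positivity)]
    nlinarith
  have hvar : A * B = s * (a / b) * (s * (b / a)) := by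
    rw [← hs2]; field_simp
  have hBB : s * (b / a) ≤ B := by
    refine le_of_mul_le_mul_left ?_ (show 0 < s * (a / b) by positivity)
    rw [← hvar]
    exact mul_le_mul_of_nonneg_right hAA hB.le
  refine (two_point_le_two_point hf hA (by positivity) hAA hBB hvar).trans (le_of_eq ?_)
  rw [bsAverage, hu, hv, hpb, hpa, div_eq_iff (by positivity)]
  generalize f (y - s * (a / b)) = P
  generalize f (y + s * (b / a)) = R
  field_simp
  linear_combination (b ^ 2 * P + a ^ 2 * R) * -h1

/-! ### Comparison along a submartingale -/

/-- Monotonicity bounds `f(S)` above by `f(-K)`, and the tangent at `0` bounds it below by an affine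
function of `S`. -/
lemma FMinus3.integrable_comp {f : ℝ → ℝ} (hf : f ∈ FMinus3) {Ω : Type u}
    [MeasurableSpace Ω] {μ : Measure Ω} [IsProbabilityMeasure μ] {S : Ω → ℝ} {K : ℝ}
    (hS : Integrable S μ) (hK : ∀ᵐ ω ∂μ, -K ≤ S ω) : Integrable (fun ω => f (S ω)) μ := by
  obtain ⟨f₁, -, h1, -, -, ha, hv, -⟩ := mem_FMinus3_iff.1 hf
  have htan : ∀ x, f 0 + f₁ 0 * x ≤ f x := by
    intro x
    rcases lt_trichotomy x 0 with h | rfl | h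
    · have := hv.slope_le_of_hasDerivAt (Set.mem_univ x) (Set.mem_univ 0) h (h1 0)
      rw [slope_def_field, div_le_iff₀ (by linarith)] at this
      linarith
    · simp
    · have := hv.le_slope_of_hasDerivAt (Set.mem_univ 0) (Set.mem_univ x) h (h1 0)
      rw [slope_def_field, le_div_iff₀ (by linarith)] at this
      linarith
  refine Integrable.mono' (g := fun ω => |f (-K)| + (|f 0| + |f₁ 0| * |S ω|))
    ((integrable_const _).add ((integrable_const _).add (hS.abs.const_mul _)))
    ((FMinus3.continuous hf).comp_aestronglyMeasurable hS.1) ?_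
  filter_upwards [hK] with ω hω
  rw [Real.norm_eq_abs, abs_le]
  have t1 := htan (S ω)
  have t2 := ha hω
  have t3 := neg_abs_le (f 0)
  have t4 := neg_abs_le (f₁ 0 * S ω)
  rw [abs_mul] at t4
  have t5 := le_abs_self (f (-K))
  have t6 := abs_nonneg (f (-K))
  have t7 := abs_nonneg (f 0)
  have t8 : 0 ≤ |f₁ 0| * |S ω| := by positivity
  constructor <;> linarith

lemma le_mul_of_sqrt_le {p A B c : ℝ} (hp₀ : 0 < p) (hp₁ : p < 1) (hA : 0 < A) (hB : 0 < B)
    (hc : √(A * B) ≤ c) (hAB : A / B ≤ p / (1 - p)) : A ≤ c * √(p / (1 - p)) := by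
  have hq : 0 < 1 - p := by linarith
  have h : A ≤ √(A * B) * √(p / (1 - p)) := by
    rw [← Real.sqrt_mul (by positivity)]
    apply Real.le_sqrt_of_sq_le
    rw [div_le_iff₀ hB] at hAB
    nlinarith
  exact h.trans (mul_le_mul_of_nonneg_right hc (Real.sqrt_nonneg _))

/-- On the range of the step, `f` lies below its chord, whose slope `-l` is nonpositive and known in
advance. The conditional drift being nonnegative, the linear term can be discarded, leaving a
centred two-point law. -/
lemma integral_step_le {p : ℝ} (hp₀ : 0 < p) (hp₁ : p < 1) {f : ℝ → ℝ} (hf : f ∈ FMinus3)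
    {Ω : Type u} {m mΩ : MeasurableSpace Ω} {μ : Measure Ω} [IsProbabilityMeasure μ]
    (hm : m ≤ mΩ) {S X A B : Ω → ℝ} {c K : ℝ} (hSm : StronglyMeasurable[m] S)
    (hS : Integrable S μ) (hK : ∀ᵐ ω ∂μ, -K ≤ S ω) (hX : Integrable X μ)
    (hXm : 0 ≤ᵐ[μ] μ[X | m]) (hA : Measurable[m] A) (hB : Measurable[m] B)
    (hpos : ∀ᵐ ω ∂μ, 0 < A ω ∧ 0 < B ω) (hXAB : ∀ᵐ ω ∂μ, -A ω ≤ X ω ∧ X ω ≤ B ω)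
    (hc : ∀ᵐ ω ∂μ, √(A ω * B ω) ≤ c) (hAB : ∀ᵐ ω ∂μ, A ω / B ω ≤ p / (1 - p)) :
    ∫ ω, f (S ω + X ω) ∂μ ≤ ∫ ω, bsAverage p f c (S ω) ∂μ := by
  obtain ⟨f₁, f₂, h1, h2, -, ha, hv, -⟩ := mem_FMinus3_iff.1 hf
  have hf1 : Monotone f₁ := by
    refine monotone_of_hasDerivAt_nonneg h2 fun x => ?_
    exact FMinus3.second_deriv_nonneg h1 h2 hv x
  have hA' : ∀ᵐ ω ∂μ, A ω ≤ c * √(p / (1 - p)) := by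
    filter_upwards [hpos, hc, hAB] with ω h3 h4 h5
    exact le_mul_of_sqrt_le hp₀ hp₁ h3.1 h3.2 h4 h5
  set v := √(p / (1 - p))
  set l : Ω → ℝ := fun ω => (f (S ω - A ω) - f (S ω + B ω)) / (A ω + B ω) with hl
  have hlm : Measurable[m] l := by
    have hfm : Measurable f := (FMinus3.continuous hf).measurable
    have hSm' : Measurable[m] S := hSm.measurable
    exact ((hfm.comp (hSm'.sub hA)).sub (hfm.comp (hSm'.add hB))).div (hA.add hB)
  have hl0 : ∀ᵐ ω ∂μ, 0 ≤ l ω := by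
    filter_upwards [hpos] with ω h3
    exact div_nonneg (sub_nonneg.2 (ha (by linarith [h3.1, h3.2]))) (by linarith [h3.1, h3.2])
  -- The left endpoint of the chord stays above `-K - c v`, and slopes of a convex function are
  -- bounded below by the derivative there.
  have hlb : ∀ᵐ ω ∂μ, ‖l ω‖ ≤ -f₁ (-K - c * v) := by
    filter_upwards [hpos, hl0, hA', hK] with ω h3 h4 h5 h6
    rw [Real.norm_of_nonneg h4]
    have := hv.le_slope_of_hasDerivAt (Set.mem_univ (S ω - A ω)) (Set.mem_univ (S ω + B ω))
      (by linarith [h3.1, h3.2]) (h1 _)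
    have h7 := hf1 (show -K - c * v ≤ S ω - A ω by linarith)
    rw [slope_def_field] at this
    have e : l ω = -((f (S ω + B ω) - f (S ω - A ω)) / (S ω + B ω - (S ω - A ω))) := by
      rw [hl, ← neg_div]
      ring_nf
    rw [e]
    linarith
  have hlX : Integrable (fun ω => l ω * X ω) μ :=
    hX.bdd_mul (hlm.mono hm le_rfl).aestronglyMeasurable hlb
  have hlX0 : 0 ≤ ∫ ω, l ω * X ω ∂μ := by
    rw [← integral_condExp hm]
    refine integral_nonneg_of_ae ?_
    have := condExp_stronglyMeasurable_mul_of_bound hm hlm.stronglyMeasurable hX _ hlb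
    filter_upwards [this, hl0, hXm] with ω h3 h4 h5
    have h3' : (μ[fun ω => l ω * X ω | m]) ω = l ω * (μ[X | m]) ω := h3
    rw [h3']
    exact mul_nonneg h4 h5
  have hI1 : Integrable (fun ω => f (S ω + X ω)) μ := by
    refine FMinus3.integrable_comp (K := K + c * v) hf (hS.add hX) ?_
    filter_upwards [hK, hA', hXAB] with ω h3 h4 h5
    linarith [h5.1]
  have hI2 : Integrable (fun ω => bsAverage p f c (S ω)) μ :=
    FMinus3.integrable_comp (FMinus3.bsAverage hp₀ hp₁ hf c) hS hK
  calc ∫ ω, f (S ω + X ω) ∂μ ≤ ∫ ω, (bsAverage p f c (S ω) - l ω * X ω) ∂μ := by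
        refine integral_mono_ae hI1 (hI2.sub hlX) ?_
        filter_upwards [hpos, hXAB, hc, hAB] with ω h3 h4 h5 h6
        have h7 := two_point_le_bsAverage hp₀ hp₁ hf h3.1 h3.2 h5 h6 (S ω)
        have h8 := hv.three_point (show S ω - A ω ≤ S ω + X ω by linarith [h4.1])
          (show S ω + X ω ≤ S ω + B ω by linarith [h4.2])
        have hABp : 0 < A ω + B ω := by linarith [h3.1, h3.2]
        have h9 : f (S ω + X ω) ≤
            (B ω * f (S ω - A ω) + A ω * f (S ω + B ω)) / (A ω + B ω) - l ω * X ω := by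
          rw [hl, div_mul_eq_mul_div, ← sub_div, le_div_iff₀ hABp]
          linarith
        linarith
    _ = ∫ ω, bsAverage p f c (S ω) ∂μ - ∫ ω, l ω * X ω ∂μ := integral_sub hI2 hlX
    _ ≤ _ := by linarith

/-- Induction on the last step. All `f` are treated at once because the step replaces `f` by its
average, and a lower bound for the final value is carried along for integrability. -/
lemma integral_last_le {p : ℝ} (hp₀ : 0 < p) (hp₁ : p < 1) {Ω : Type u}
    {mΩ : MeasurableSpace Ω} {μ : Measure Ω} [IsProbabilityMeasure μ] (n : ℕ) :
    ∀ (H : Fin n → MeasurableSpace Ω) (S : Fin (n + 1) → Ω → ℝ) (A B : Fin n → Ω → ℝ)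
      (c : Fin n → ℝ), (∀ i, H i ≤ mΩ) →
      (∀ i : Fin n, StronglyMeasurable[H i] (S i.castSucc)) → (∀ i, Integrable (S i) μ) →
      (∀ᵐ ω ∂μ, 0 ≤ S 0 ω) →
      (∀ i : Fin n, 0 ≤ᵐ[μ] μ[S i.succ - S i.castSucc | H i]) →
      (∀ i, Measurable[H i] (A i)) → (∀ i, Measurable[H i] (B i)) →
      (∀ i, ∀ᵐ ω ∂μ, 0 < A i ω ∧ 0 < B i ω) →
      (∀ i : Fin n, ∀ᵐ ω ∂μ,
          -A i ω ≤ S i.succ ω - S i.castSucc ω ∧ S i.succ ω - S i.castSucc ω ≤ B i ω) →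
      (∀ i, ∀ᵐ ω ∂μ, √(A i ω * B i ω) ≤ c i) →
      (∀ i, ∀ᵐ ω ∂μ, A i ω / B i ω ≤ p / (1 - p)) →
      (∃ K, ∀ᵐ ω ∂μ, -K ≤ S (Fin.last n) ω) ∧
        ∀ f ∈ FMinus3, ∫ ω, f (S (Fin.last n) ω) ∂μ ≤ bsMoment p f c := by
  induction n with
  | zero =>
    intro H S A B c _ _ hS h0 _ _ _ _ _ _ _
    refine ⟨⟨0, by simpa using h0⟩, fun f hf => ?_⟩
    rw [bsMoment_zero hp₀ hp₁ (FMinus3.continuous hf)]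
    have hI : Integrable (fun ω => f (S 0 ω)) μ :=
      FMinus3.integrable_comp (K := 0) hf (hS 0) (by simpa using h0)
    calc ∫ ω, f (S (Fin.last 0) ω) ∂μ ≤ ∫ _, f 0 ∂μ :=
          integral_mono_ae hI (integrable_const _) (by
            filter_upwards [h0] with ω hω
            exact hf.2.1 hω)
      _ = f 0 := by simp
  | succ n ih =>
    intro H S A B c hH hSm hS h0 hX hA hB hpos hXAB hc hAB
    obtain ⟨⟨K, hK⟩, hle⟩ := ih (fun i => H i.castSucc) (fun i => S i.castSucc)
      (fun i => A i.castSucc) (fun i => B i.castSucc) (fun i => c i.castSucc)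
      (fun i => hH _) (fun i => hSm _) (fun i => hS _) h0 (fun i => hX i.castSucc)
      (fun i => hA _) (fun i => hB _) (fun i => hpos _) (fun i => hXAB i.castSucc)
      (fun i => hc _) (fun i => hAB _)
    have hcast : ∀ ω, S (Fin.last n).castSucc ω +
        (S (Fin.last n).succ - S (Fin.last n).castSucc) ω = S (Fin.last (n + 1)) ω := by
      intro ω
      simp
    refine ⟨⟨K + c (Fin.last n) * √(p / (1 - p)), ?_⟩, fun f hf => ?_⟩
    · filter_upwards [hK, hpos (Fin.last n), hXAB (Fin.last n), hc (Fin.last n),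
        hAB (Fin.last n)] with ω h3 h4 h5 h6 h7
      have := le_mul_of_sqrt_le hp₀ hp₁ h4.1 h4.2 h6 h7
      rw [Fin.succ_last] at h5
      linarith [h5.1]
    · have hstep := integral_step_le hp₀ hp₁ hf (hH (Fin.last n)) (hSm (Fin.last n))
        (hS _) hK ((hS (Fin.last n).succ).sub (hS (Fin.last n).castSucc)) (hX (Fin.last n))
        (hA _) (hB _) (hpos _) (hXAB _) (hc _) (hAB _)
      simp only [hcast] at hstep
      refine hstep.trans ((hle _ (FMinus3.bsAverage hp₀ hp₁ hf _)).trans (le_of_eq ?_))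
      rw [bsMoment_succAbove hp₀ hp₁ (FMinus3.continuous hf) c (Fin.last n)]
      simp

/-! ### Partial sums of independent variables -/

/-- The indices below `k`. -/
def below {n : ℕ} (k : Fin (n + 1)) : Finset (Fin n) :=
  Finset.univ.filter fun i => i.castSucc < k

lemma below_mono {n : ℕ} {j k : Fin (n + 1)} (h : j ≤ k) : below j ⊆ below k := fun i hi => by
  simp only [below, Finset.mem_filter, Finset.mem_univ, true_and] at hi ⊢
  exact hi.trans_le h

lemma below_succ {n : ℕ} (i : Fin n) : below i.succ = insert i (below i.castSucc) := by
  ext j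
  simp only [below, Finset.mem_filter, Finset.mem_univ, true_and, Finset.mem_insert, Fin.lt_def,
    Fin.val_castSucc, Fin.val_succ, Fin.ext_iff]
  omega

lemma below_last (n : ℕ) : below (Fin.last n) = Finset.univ := by
  ext j
  simp [below, Fin.castSucc_lt_last]

lemma below_zero (n : ℕ) : below (0 : Fin (n + 1)) = ∅ := by
  ext j
  simp [below]

/-- The filtration generated by `X`, indexed by the number of variables observed. -/
def tupleFiltration {n : ℕ} {Ω : Type u} {mΩ : MeasurableSpace Ω} {X : Fin n → Ω → ℝ}
    (hX : ∀ i, Measurable (X i)) : Filtration (Fin (n + 1)) mΩ where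
  seq k := MeasurableSpace.comap (fun ω (i : below k) => X i ω) MeasurableSpace.pi
  mono' j k hjk := by
    rintro _ ⟨s, hs, rfl⟩
    have hr : Measurable fun (x : below k → ℝ) (i : below j) => x ⟨i, below_mono hjk i.2⟩ :=
      measurable_pi_lambda _ fun i => measurable_pi_apply _
    exact ⟨_, hr hs, rfl⟩
  le' k := (measurable_pi_lambda _ fun i => hX _).comap_le

/-- The increment from `j` to `k` uses indices disjoint from those already observed, so its
conditional expectation is its mean. -/
lemma submartingale_partialSum {n : ℕ} {Ω : Type u} {mΩ : MeasurableSpace Ω} {μ : Measure Ω}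
    [IsProbabilityMeasure μ] {X : Fin n → Ω → ℝ} (hX : ∀ i, Measurable (X i))
    (hind : iIndepFun X μ) (hint : ∀ i, Integrable (X i) μ) (h0 : ∀ i, 0 ≤ ∫ ω, X i ω ∂μ) :
    Submartingale (fun k => ∑ i ∈ below k, X i) (tupleFiltration hX) μ := by
  have hmeas : ∀ s : Finset (Fin n), Measurable[MeasurableSpace.comap
      (fun ω (i : s) => X i ω) MeasurableSpace.pi] (∑ i ∈ s, X i) := by
    intro s
    have hg : Measurable fun x : s → ℝ => ∑ i : s, x i := by fun_prop
    have : (∑ i ∈ s, X i) = (fun x : s → ℝ => ∑ i : s, x i) ∘ (fun ω (i : s) => X i ω) := by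
      funext ω
      rw [Finset.sum_apply, Function.comp_apply, ← Finset.sum_coe_sort]
    rw [this]
    exact hg.comp (comap_measurable _)
  have hintS : ∀ s : Finset (Fin n), Integrable (∑ i ∈ s, X i) μ := fun s =>
    integrable_finsetSum' s fun i _ => hint i
  refine ⟨fun k => (hmeas (below k)).stronglyMeasurable, fun j k hjk => ?_, fun k => hintS _⟩
  set D := below k \ below j with hD
  have hle : (tupleFiltration hX) j ≤ mΩ := (tupleFiltration hX).le j
  have hsplit : (∑ i ∈ below k, X i) = (∑ i ∈ below j, X i) + ∑ i ∈ D, X i := by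
    rw [add_comm, hD, Finset.sum_sdiff (below_mono hjk)]
  have hleD : MeasurableSpace.comap (fun ω (i : D) => X i ω) MeasurableSpace.pi ≤ mΩ :=
    (measurable_pi_lambda _ fun i => hX _).comap_le
  have hindep : Indep (MeasurableSpace.comap (fun ω (i : D) => X i ω) MeasurableSpace.pi)
      ((tupleFiltration hX) j) μ :=
    (IndepFun_iff_Indep _ _ _).1 (hind.indepFun_finset D (below j) Finset.sdiff_disjoint hX)
  have h1 := condExp_indep_eq hleD hle (hmeas D).stronglyMeasurable hindep
  have h2 := condExp_add (μ := μ) (hintS (below j)) (hintS D) ((tupleFiltration hX) j)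
  have h3 := condExp_of_stronglyMeasurable hle (hmeas (below j)).stronglyMeasurable
    (hintS (below j))
  simp only [hsplit]
  filter_upwards [h1, h2] with ω e1 e2
  rw [e2, Pi.add_apply, h3, e1]
  have : 0 ≤ ∫ ω, (∑ i ∈ D, X i) ω ∂μ := by
    simp only [Finset.sum_apply]
    rw [integral_finsetSum _ fun i _ => hint i]
    exact Finset.sum_nonneg fun i _ => h0 i
  linarith

/-! ### A realization of the standardized Bernoulli variables -/

lemma ae_bsLaw (p : ℝ) : ∀ᵐ x ∂bsLaw p, -√(p / (1 - p)) ≤ x ∧ x ≤ √((1 - p) / p) := by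
  have h1 := Real.sqrt_nonneg ((1 - p) / p)
  have h2 := Real.sqrt_nonneg (p / (1 - p))
  rw [bsLaw, ae_add_measure_iff]
  constructor
  · refine Measure.ae_smul_measure ?_ _
    rw [ae_dirac_eq]
    exact ⟨by linarith, le_rfl⟩
  · refine Measure.ae_smul_measure ?_ _
    rw [ae_dirac_eq]
    exact ⟨le_rfl, by linarith⟩

lemma integral_id_bsLaw {p : ℝ} (hp₀ : 0 < p) (hp₁ : p < 1) : ∫ x, x ∂bsLaw p = 0 := by
  obtain ⟨a, b, ha, hb, h1, hpa, hpb, hu, hv⟩ := exists_sqrt_param hp₀ hp₁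
  have hi : ∀ x : ℝ, Integrable (fun y : ℝ => y) (Measure.dirac x) := fun x =>
    integrable_dirac (by simp)
  rw [bsLaw, integral_add_measure ((hi _).smul_measure ENNReal.ofReal_ne_top)
    ((hi _).smul_measure ENNReal.ofReal_ne_top), integral_smul_measure, integral_smul_measure,
    integral_dirac, integral_dirac, ENNReal.toReal_ofReal hp₀.le,
    ENNReal.toReal_ofReal (by linarith), hu, hv, hpb, hpa]
  simp only [smul_eq_mul]
  field_simp
  ring

/-- The product space carrying `n` independent standardized Bernoulli variables, in any
universe. -/
noncomputable def liftedLaw (p : ℝ) (n : ℕ) : Measure (Fin n → ULift.{u} ℝ) :=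
  Measure.pi fun _ => (bsLaw p).map ULift.up


lemma isProbabilityMeasure_map_up {p : ℝ} (hp₀ : 0 < p) (hp₁ : p < 1) :
    IsProbabilityMeasure ((bsLaw p).map (ULift.up.{u})) :=
  have := isProbabilityMeasure_bsLaw hp₀ hp₁
  Measure.isProbabilityMeasure_map measurable_up.aemeasurable

lemma isProbabilityMeasure_liftedLaw {p : ℝ} (hp₀ : 0 < p) (hp₁ : p < 1) (n : ℕ) :
    IsProbabilityMeasure (liftedLaw.{u} p n) :=
  have := isProbabilityMeasure_map_up.{u} hp₀ hp₁
  inferInstanceAs (IsProbabilityMeasure (Measure.pi fun _ : Fin n => (bsLaw p).map ULift.up))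

lemma map_down_map_up (p : ℝ) : ((bsLaw p).map (ULift.up.{u})).map ULift.down = bsLaw p := by
  rw [Measure.map_map measurable_down measurable_up]
  exact Measure.map_id

lemma map_eval_liftedLaw {p : ℝ} (hp₀ : 0 < p) (hp₁ : p < 1) {n : ℕ} (i : Fin n) :
    (liftedLaw.{u} p n).map (fun ω => (ω i).down) = bsLaw p := by
  have := isProbabilityMeasure_map_up.{u} hp₀ hp₁
  have h := (measurePreserving_eval (fun _ : Fin n => (bsLaw p).map (ULift.up.{u})) i).map_eq
  calc _ = ((liftedLaw.{u} p n).map (Function.eval i)).map ULift.down :=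
        (Measure.map_map measurable_down (measurable_pi_apply i)).symm
    _ = _ := by rw [liftedLaw, h, map_down_map_up]

lemma bsMoment_eq_integral_liftedLaw {p : ℝ} (hp₀ : 0 < p) (hp₁ : p < 1) {n : ℕ} {f : ℝ → ℝ}
    (hf : Continuous f) (c : Fin n → ℝ) :
    bsMoment p f c = ∫ ω, f (∑ i, c i * (ω i).down) ∂(liftedLaw.{u} p n) := by
  have := isProbabilityMeasure_map_up.{u} hp₀ hp₁
  have hm : Measurable fun (ω : Fin n → ULift.{u} ℝ) i => (ω i).down :=
    measurable_pi_lambda _ fun i => measurable_down.comp (measurable_pi_apply i)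
  have : IsProbabilityMeasure (((bsLaw p).map (ULift.up.{u})).map ULift.down) :=
    Measure.isProbabilityMeasure_map measurable_down.aemeasurable
  have hmap : bsLawPi p n = (liftedLaw.{u} p n).map (fun ω i => (ω i).down) := by
    rw [liftedLaw, Measure.pi_map_pi (fun _ => measurable_down.aemeasurable)]
    simp only [map_down_map_up, bsLawPi]
  rw [bsMoment, hmap, integral_map hm.aemeasurable
    (Continuous.aestronglyMeasurable (by fun_prop))]

lemma powerMean_const_fin_one {m : ℝ} (hm : 1 ≤ m) {c : Fin 1 → ℝ} (hc : ∀ i, 0 ≤ c i) :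
    (fun _ : Fin 1 => powerMean m c) = c := by
  funext i
  rw [Subsingleton.elim i 0]
  have : (c 0 ^ (2 * m)) ^ (1 / (2 * m)) = c 0 := by
    rw [← Real.rpow_mul (hc 0), mul_one_div_cancel (by positivity), Real.rpow_one]
  simpa [powerMean] using this

lemma sq_rpow_eq {m x : ℝ} (hx : 0 ≤ x) : (x ^ 2) ^ m = x ^ (2 * m) := by
  rw [← Real.rpow_natCast, ← Real.rpow_mul hx]
  norm_num

end LeftTail

/-! ### The cycle of implications -/

open LeftTail in
theorem mainTheorem7 (p q m : ℝ) (hp₀ : 0 < p) (hp₁ : p < 1) (hq : q = 1 - p) (hm : 1 ≤ m) :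
    List.TFAE [
      -- (I)
      m ≥ LeftTail.mStar q,
      -- (II)
      ∀ f ∈ LeftTail.FMinus3, ∀ n : ℕ, 2 ≤ n → ∀ c : Fin n → ℝ, (∀ i, 0 ≤ c i) →
        LeftTail.bsMoment p f c ≤
          LeftTail.bsMoment p f (fun _ : Fin n => LeftTail.powerMean m c),
      -- (III)
      ∀ f ∈ LeftTail.FMinus3, ∀ c : Fin 2 → ℝ, (∀ i, 0 ≤ c i) →
        LeftTail.bsMoment p f c ≤
          LeftTail.bsMoment p f (fun _ : Fin 2 => LeftTail.powerMean m c),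
      -- (IV)
      ∀ n : ℕ, 2 ≤ n → ∀ f ∈ LeftTail.FMinus3,
        LeftTail.SchurConcave (fun a : Fin n → ℝ =>
          LeftTail.bsMoment p f (fun i => a i ^ (1 / (2 * m)))),
      -- (V)
      ∀ f ∈ LeftTail.FMinus3,
        LeftTail.SchurConcave (fun a : Fin 2 → ℝ =>
          LeftTail.bsMoment p f (fun i => a i ^ (1 / (2 * m)))),
      -- (VI)
      ∀ (n : ℕ), 1 ≤ n →
        ∀ (Ω : Type u) [MeasurableSpace Ω] (μ : Measure Ω) [IsProbabilityMeasure μ]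
          (X : Fin n → Ω → ℝ) (a b : Fin n → ℝ),
        (∀ i, Measurable (X i)) → iIndepFun X μ →
        (∀ i, 0 < a i) → (∀ i, 0 < b i) → (∀ i, a i / b i ≤ p / q) →
        (∀ i, ∀ᵐ ω ∂μ, -a i ≤ X i ω ∧ X i ω ≤ b i) →
        (∀ i, 0 ≤ ∫ ω, X i ω ∂μ) →
        ∀ f ∈ LeftTail.FMinus3,
          Integrable (fun ω => f (∑ i, X i ω)) μ ∧
          ∫ ω, f (∑ i, X i ω) ∂μ ≤
            LeftTail.bsMoment p f (fun _ : Fin n =>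
              (1 / (n : ℝ) * ∑ i, (a i * b i) ^ m) ^ (1 / (2 * m))),
      -- (VII)
      ∀ (n : ℕ), 1 ≤ n →
        ∀ (Ω : Type u) (mΩ : MeasurableSpace Ω) (μ : Measure Ω) [IsProbabilityMeasure μ]
          (H : Filtration (Fin (n + 1)) mΩ) (S : Fin (n + 1) → Ω → ℝ)
          (A B : Fin n → Ω → ℝ) (c : Fin n → ℝ),
        Submartingale S H μ → (∀ᵐ ω ∂μ, 0 ≤ S 0 ω) →
        (∀ i : Fin n, Measurable[H i.castSucc] (A i)) →
        (∀ i : Fin n, Measurable[H i.castSucc] (B i)) →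
        (∀ i : Fin n, ∀ᵐ ω ∂μ, 0 < A i ω ∧ 0 < B i ω) →
        (∀ i : Fin n, ∀ᵐ ω ∂μ,
          -A i ω ≤ S i.succ ω - S i.castSucc ω ∧ S i.succ ω - S i.castSucc ω ≤ B i ω) →
        (∀ i : Fin n, ∀ᵐ ω ∂μ, √(A i ω * B i ω) ≤ c i) →
        (∀ i : Fin n, ∀ᵐ ω ∂μ, A i ω / B i ω ≤ p / q) →
        ∀ f ∈ LeftTail.FMinus3,
          Integrable (fun ω => f (S (Fin.last n) ω)) μ ∧
          ∫ ω, f (S (Fin.last n) ω) ∂μ ≤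
            LeftTail.bsMoment p f (fun _ : Fin n => LeftTail.powerMean m c)] := by
  subst hq
  tfae_have 1 → 4 := fun h n _ f hf => schurConcave_bsMoment hp₀ hp₁ hm h hf n
  tfae_have 4 → 2 := fun h f hf n hn c hc =>
    bsMoment_le_of_schurConcave hm (by omega) (h n hn f hf) c hc
  tfae_have 2 → 3 := fun h f hf c hc => h f hf 2 le_rfl c hc
  tfae_have 3 → 1 := fun h =>
    mStar_le_of_bsMoment_le hp₀ hp₁ hm fun f hf c hc => h f hf c fun i => (hc i).le
  tfae_have 4 → 5 := fun h f hf => h 2 le_rfl f hf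
  tfae_have 5 → 3 := fun h f hf c hc => bsMoment_le_of_schurConcave hm two_pos (h f hf) c hc
  tfae_have 2 → 7 := by
    intro h n hn Ω mΩ μ _ H S A B c hS h0 hA hB hpos hAB hc hr f hf
    obtain ⟨⟨K, hK⟩, hle⟩ := integral_last_le hp₀ hp₁ n (fun i => H i.castSucc) S A B c
      (fun i => H.le _) (fun i => hS.1 _) hS.2.2 h0
      (fun i => hS.condExp_sub_nonneg i.castSucc_le_succ) hA hB hpos hAB hc hr
    refine ⟨FMinus3.integrable_comp hf (hS.2.2 _) hK, (hle f hf).trans ?_⟩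
    have hc0 : ∀ i, 0 ≤ c i := fun i => by
      obtain ⟨ω, hω⟩ := (hc i).exists
      exact (Real.sqrt_nonneg _).trans hω
    -- The power-mean inequality is assumed only from `n = 2` on; for `n = 1` the power mean is the
    -- coefficient itself.
    rcases hn.eq_or_lt with rfl | hn2
    · rw [powerMean_const_fin_one hm hc0]
    · exact h f hf n hn2 c hc0
  tfae_have 7 → 6 := by
    intro h n hn Ω mΩ μ _ X a b hX hind ha hb hab hXab h0 f hf
    have hint : ∀ i, Integrable (X i) μ := fun i =>
      Integrable.of_mem_Icc (-a i) (b i) (hX i).aemeasurable (hXab i)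
    have hdiff : ∀ (i : Fin n) (ω : Ω), (∑ j ∈ below i.succ, X j) ω -
        (∑ j ∈ below i.castSucc, X j) ω = X i ω := by
      intro i ω
      rw [below_succ, Finset.sum_insert (by simp [below])]
      simp
    have := h n hn Ω mΩ μ (tupleFiltration hX) (fun k => ∑ i ∈ below k, X i)
      (fun i _ => a i) (fun i _ => b i) (fun i => √(a i * b i))
      (submartingale_partialSum hX hind hint h0) (by simp [below_zero])
      (fun _ => measurable_const) (fun _ => measurable_const)
      (fun i => Filter.Eventually.of_forall fun _ => ⟨ha i, hb i⟩)
      (fun i => by simpa only [hdiff] using hXab i)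
      (fun i => Filter.Eventually.of_forall fun _ => le_rfl)
      (fun i => Filter.Eventually.of_forall fun _ => hab i) f hf
    have hpm : powerMean m (fun i => √(a i * b i)) =
        (1 / (n : ℝ) * ∑ i, (a i * b i) ^ m) ^ (1 / (2 * m)) := by
      rw [powerMean]
      congr 2
      refine Finset.sum_congr rfl fun i _ => ?_
      rw [← sq_rpow_eq (Real.sqrt_nonneg _), Real.sq_sqrt (mul_pos (ha i) (hb i)).le]
    simpa only [below_last, Finset.sum_apply, hpm] using this
  tfae_have 6 → 1 := by
    intro h
    -- Take `Xᵢ = cᵢ BSᵢ` with its exact range: the endpoint product is `cᵢ²` and the endpoint ratio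
    -- is `p/q`, the extreme allowed value.
    refine mStar_le_of_bsMoment_le hp₀ hp₁ hm fun f hf c hc => ?_
    have := isProbabilityMeasure_map_up.{u} hp₀ hp₁
    have := isProbabilityMeasure_liftedLaw.{u} hp₀ hp₁ 2
    have hq : 0 < 1 - p := by linarith
    have hu : 0 < √((1 - p) / p) := Real.sqrt_pos.2 (by positivity)
    have hv : 0 < √(p / (1 - p)) := Real.sqrt_pos.2 (by positivity)
    have huv : √(p / (1 - p)) * √((1 - p) / p) = 1 := by
      rw [← Real.sqrt_mul (by positivity), div_mul_div_cancel₀ hq.ne', div_self hp₀.ne',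
        Real.sqrt_one]
    have hmd : ∀ i : Fin 2, Measurable fun ω : Fin 2 → ULift.{u} ℝ => (ω i).down := fun i =>
      measurable_down.comp (measurable_pi_apply i)
    have := (h 2 one_le_two (Fin 2 → ULift.{u} ℝ) (liftedLaw p 2)
      (fun i ω => c i * (ω i).down) (fun i => c i * √(p / (1 - p)))
      (fun i => c i * √((1 - p) / p)) (fun i => (hmd i).const_mul _)
      (iIndepFun_pi (X := fun (i : Fin 2) (x : ULift.{u} ℝ) => c i * x.down)
        fun i => (measurable_down.const_mul _).aemeasurable)
      (fun i => mul_pos (hc i) hv) (fun i => mul_pos (hc i) hu) (fun i => ?_) (fun i => ?_)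
      (fun i => ?_) f hf).2
    · rw [← bsMoment_eq_integral_liftedLaw hp₀ hp₁ (FMinus3.continuous hf)] at this
      refine this.trans (le_of_eq ?_)
      congr 1
      funext _
      rw [powerMean]
      congr 2
      refine Finset.sum_congr rfl fun i _ => ?_
      rw [mul_mul_mul_comm, huv, mul_one, ← sq, sq_rpow_eq (hc i).le]
    · rw [mul_div_mul_left _ _ (hc i).ne', div_le_iff₀ hu]
      refine le_of_mul_le_mul_right ?_ hv
      rw [mul_assoc, mul_comm (√((1 - p) / p)), huv, ← sq, Real.sq_sqrt (by positivity), mul_one]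
    · have hae := ae_bsLaw p
      rw [← map_eval_liftedLaw.{u} hp₀ hp₁ i] at hae
      filter_upwards [ae_of_ae_map (hmd i).aemeasurable hae] with ω hω
      constructor
      · rw [← mul_neg]
        exact mul_le_mul_of_nonneg_left hω.1 (hc i).le
      · exact mul_le_mul_of_nonneg_left hω.2 (hc i).le
    · have hi := integral_id_bsLaw hp₀ hp₁
      rw [← map_eval_liftedLaw.{u} hp₀ hp₁ i, integral_map (hmd i).aemeasurable
        (by fun_prop)] at hi
      rw [integral_const_mul, hi, mul_zero]
  tfae_finish
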